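/- **The CCV $\lambda\mu$-calculus.** Let $x,y,z$ range over ordinary variables and $k,l$ over continuation variables. Terms $M$ and jumps $J$ are generated by $$M ::= x \mid \lambda x.\,M \mid M\,M \mid M\lceil x:=M\rceil \mid \mu k.\,J,\qquad J ::= [k]M \mid J\lceil x:=M\rceil ,$$ where $M\lceil x:=N\rceil$ stands for $\mathsf{let}\ x=N\ \mathsf{in}\ M$ and binds $x$ in $M$ (similarly for $J\lceil x:=N\rceil$), $\lambda x$ binds $x$ and $\mu k$ binds $k$. Expressions are taken up to renaming of bound variables and up to the least congruence containing $$L\lceil x:=M\lceil y:=N\rceil\rceil=(L\lceil x:=M\rceil)\lceil y:=N\rceil\ \ (y\notin L),\qquad [k](L\lceil x:=M\rceil)=([k]L)\lceil x:=M\rceil ,$$ where $y\notin L$ means that $y$ is not free in $L$. A value $V$ is a variable or a lambda abstraction; below $N$ denotes a non-value and $L,M$ arbitrary terms. Reduction $\to$ is the closure under all contexts of $$\begin{array}{rll} NM&\to (zM)\lceil z:=N\rceil&(z\text{ fresh})\\ VN&\to (Vz)\lceil z:=N\rceil&(z\text{ fresh})\\ (\lambda x.\,M)V&\to M\lceil x:=V\rceil\\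 M\lceil x:=V\rceil&\to M\{V/x\}\\ M\lceil x:=\mu k.\,J\rceil&\to \mu k.\,J\{[k]\square\mapsto[k](M\lceil x:=\square\rceil)\}&(k\notin M)\\ [l]\mu k.\,J&\to J\{l/k\}\\ \lambda x.\,Vx&\to V&(x\notin V)\\ x\lceil x:=M\rceil&\to M\\ \mu k.\,[k]M&\to M&(k\notin M)\\ (\mu k.\,J)\lceil x:=M\rceil&\to\mu k.\,(J\lceil x:=M\rceil)&(k\notin M). \end{array}$$ **The target calculus** is the sorted $\lambda$-calculus $$T::=\lambda k.\,Q\mid WW,\qquad Q::=KW\mid TK,\qquad W::=x\mid\lambda x.\,T,\qquad K::=k\mid\lambda x.\,Q$$ with $\beta\eta$-reduction in all contexts. **The CPS translation** is $[\![M]\!]:=\lambda k.\,\langle M\rangle[k]$ ($k$ fresh), where, with all bound variables chosen fresh, $V,V_1,V_2$ values and $N,N_1,N_2$ non-values, $$\begin{array}{rl@{\qquad}rl} \langle V\rangle[K]&=K\,V^*&\langle V_1V_2\rangle[K]&=V_1^*V_2^*K\\ \langle VN\rangle[K]&=\langle N\rangle[\lambda y.\,V^*yK]&\langle NV\rangle[K]&=\langle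 N\rangle[\lambda x.\,xV^*K]\\ \langle N_1N_2\rangle[K]&=\langle N_1\rangle[\lambda x.\,\langle N_2\rangle[\lambda y.\,xyK]]&\langle L\lceil x:=M\rceil\rangle[K]&=\langle M\rangle[\lambda x.\,\langle L\rangle[K]]\\ \langle \mu k.\,J\rangle[K]&=(\lambda k.\,\langle J\rangle)K&\langle [k]M\rangle&=\langle M\rangle[k]\\ \langle J\lceil x:=M\rceil\rangle&=\langle M\rangle[\lambda x.\,\langle J\rangle]&&\\ x^*&=x&(\lambda x.\,M)^*&=\lambda x.\,\lambda k.\,\langle M\rangle[k]. \end{array}$$ A term is *strongly normalizing* if every reduction sequence starting from it is finite. **Proposition.** Let $M$ be a term of the CCV $\lambda\mu$-calculus. If $M$ is strongly normalizing, then its CPS translation $[\![M]\!]$ is strongly normalizing in the target calculus. -/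

import Mathlib

/-- Every reduction sequence starting from `a` is finite. -/
def StronglyNormalizing {α : Type} (r : α → α → Prop) (a : α) : Prop :=
  ¬ ∃ f : ℕ → α, f 0 = a ∧ ∀ n, r (f n) (f (n + 1))

namespace CCV

/-- Extension of a renaming of de Bruijn indices under one binder. -/
def up (ρ : ℕ → ℕ) : ℕ → ℕ
  | 0 => 0
  | n + 1 => ρ n + 1

/-- The two syntactic categories of the CCV calculus: terms and jumps. -/
inductive Cat
  | term
  | jump

/-- Raw expressions of the CCV calculus, up to renaming of bound variables, as de Bruijn terms.
Ordinary variables and continuation variables have separate index spaces.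
`letE M N` is the term or the jump `M⌈x := N⌉`, that is `let x = N in M`: it binds the ordinary
variable `0` in `M`.  `lam` binds the ordinary variable `0`, `mu` the continuation variable `0`. -/
inductive Raw : Cat → Type
  | var (x : ℕ) : Raw .term
  | lam (M : Raw .term) : Raw .term
  | app (M N : Raw .term) : Raw .term
  | mu (J : Raw .jump) : Raw .term
  | jmp (k : ℕ) (M : Raw .term) : Raw .jump
  | letE {s : Cat} (M : Raw s) (N : Raw .term) : Raw s

namespace Raw

/-- Rename the free ordinary variables by `ρ` and the free continuation variables by `κ`. -/
def ren : {s : Cat} → (ρ κ : ℕ → ℕ) → Raw s → Raw s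
  | _, ρ, _, var x => var (ρ x)
  | _, ρ, κ, lam M => lam (ren (up ρ) κ M)
  | _, ρ, κ, app M N => app (ren ρ κ M) (ren ρ κ N)
  | _, ρ, κ, mu J => mu (ren ρ (up κ) J)
  | _, ρ, κ, jmp k M => jmp (κ k) (ren ρ κ M)
  | _, ρ, κ, letE M N => letE (ren (up ρ) κ M) (ren ρ κ N)

/-- Weakening by a fresh ordinary variable. -/
def wk {s : Cat} (M : Raw s) : Raw s := M.ren Nat.succ id

/-- Weakening by a fresh continuation variable. -/
def wkK {s : Cat} (M : Raw s) : Raw s := M.ren id Nat.succ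

/-- Weakening by a fresh ordinary variable just above the innermost one. -/
def wkUnder {s : Cat} (M : Raw s) : Raw s := M.ren (up Nat.succ) id

/-- Capture-avoiding simultaneous substitution for the ordinary variables. -/
def subst : {s : Cat} → (σ : ℕ → Raw .term) → Raw s → Raw s
  | _, σ, var x => σ x
  | _, σ, lam M => lam (subst (fun n => Nat.casesOn n (var 0) fun m => (σ m).wk) M)
  | _, σ, app M N => app (subst σ M) (subst σ N)
  | _, σ, mu J => mu (subst (fun n => (σ n).wkK) J)
  | _, σ, jmp k M => jmp k (subst σ M)
  | _, σ, letE M N =>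
      letE (subst (fun n => Nat.casesOn n (var 0) fun m => (σ m).wk) M) (subst σ N)

/-- `M{V/x}`, where `x` is the ordinary variable `0` of `M`. -/
def inst {s : Cat} (M : Raw s) (V : Raw .term) : Raw s :=
  M.subst fun n => Nat.casesOn n V fun m => var m

/-- `J{l/k}`, where `k` is the continuation variable `0` of `J`. -/
def instK {s : Cat} (J : Raw s) (l : ℕ) : Raw s :=
  J.ren id fun n => Nat.casesOn n l fun m => m

/-- The context substitution `E{[k]□ ↦ [k](M⌈x := □⌉)}`, where `x` is the ordinary variable `0`
of `M`.  It replaces, recursively, every free occurrence of `[k]P` in `E`. -/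
def ctxSubst : {s : Cat} → (k : ℕ) → (M : Raw .term) → Raw s → Raw s
  | _, _, _, var x => var x
  | _, k, M, lam P => lam (ctxSubst k M.wkUnder P)
  | _, k, M, app P Q => app (ctxSubst k M P) (ctxSubst k M Q)
  | _, k, M, mu J => mu (ctxSubst (k + 1) M.wkK J)
  | _, k, M, jmp l P =>
      if l = k then jmp l (letE M (ctxSubst k M P)) else jmp l (ctxSubst k M P)
  | _, k, M, letE P Q => letE (ctxSubst k M.wkUnder P) (ctxSubst k M Q)

/-- Values are the variables and the lambda abstractions. -/
def isValue : {s : Cat} → Raw s → Bool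
  | _, var _ => true
  | _, lam _ => true
  | _, _ => false

/-- Syntactic equality: the least congruence containing the two associativity axioms
`L⌈x := M⌈y := N⌉⌉ = (L⌈x := M⌉)⌈y := N⌉` (`y` not free in `L`) and
`[k](L⌈x := M⌉) = ([k]L)⌈x := M⌉`. -/
inductive Eqv : {s : Cat} → Raw s → Raw s → Prop
  | assoc (L M N : Raw .term) : Eqv (letE L (letE M N)) (letE (letE L.wkUnder M) N)
  | jmpAssoc (k : ℕ) (L M : Raw .term) : Eqv (jmp k (letE L M)) (letE (jmp k L) M)
  | refl {s : Cat} (M : Raw s) : Eqv M M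
  | symm {s : Cat} {M N : Raw s} : Eqv M N → Eqv N M
  | trans {s : Cat} {L M N : Raw s} : Eqv L M → Eqv M N → Eqv L N
  | lam {M M' : Raw .term} : Eqv M M' → Eqv (lam M) (lam M')
  | app {M M' N N' : Raw .term} : Eqv M M' → Eqv N N' → Eqv (app M N) (app M' N')
  | mu {J J' : Raw .jump} : Eqv J J' → Eqv (mu J) (mu J')
  | jmp (k : ℕ) {M M' : Raw .term} : Eqv M M' → Eqv (jmp k M) (jmp k M')
  | letE {s : Cat} {M M' : Raw s} {N N' : Raw .term} :
      Eqv M M' → Eqv N N' → Eqv (letE M N) (letE M' N')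

/-- One step of reduction between raw expressions: the ten rules, in an arbitrary context. -/
inductive Step : {s : Cat} → Raw s → Raw s → Prop
  | ad₁ (N M : Raw .term) : N.isValue = false →
      Step (app N M) (letE (app (var 0) M.wk) N)
  | ad₂ (V N : Raw .term) : V.isValue = true → N.isValue = false →
      Step (app V N) (letE (app V.wk (var 0)) N)
  | betaLam (M V : Raw .term) : V.isValue = true → Step (app (lam M) V) (letE M V)
  | betaLet (M V : Raw .term) : V.isValue = true → Step (letE M V) (M.inst V)
  | betaMu (M : Raw .term) (J : Raw .jump) :
      Step (letE M (mu J)) (mu (ctxSubst 0 M.wkK J))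
  | betaJmp (l : ℕ) (J : Raw .jump) : Step (jmp l (mu J)) (J.instK l)
  | etaLam (V : Raw .term) : V.isValue = true → Step (lam (app V.wk (var 0))) V
  | etaLet (M : Raw .term) : Step (letE (var 0) M) M
  | etaMu (M : Raw .term) : Step (mu (jmp 0 M.wkK)) M
  | exch (J : Raw .jump) (M : Raw .term) : Step (letE (mu J) M) (mu (letE J M.wkK))
  | lam {M M' : Raw .term} : Step M M' → Step (lam M) (lam M')
  | appL {M M' : Raw .term} (N : Raw .term) : Step M M' → Step (app M N) (app M' N)
  | appR (M : Raw .term) {N N' : Raw .term} : Step N N' → Step (app M N) (app M N')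
  | mu {J J' : Raw .jump} : Step J J' → Step (mu J) (mu J')
  | jmp (k : ℕ) {M M' : Raw .term} : Step M M' → Step (jmp k M) (jmp k M')
  | letL {s : Cat} {M M' : Raw s} (N : Raw .term) : Step M M' → Step (letE M N) (letE M' N)
  | letR {s : Cat} (M : Raw s) {N N' : Raw .term} : Step N N' → Step (letE M N) (letE M N')

/-- Syntactic equality as a setoid. -/
instance setoid (s : Cat) : Setoid (Raw s) :=
  ⟨Eqv, ⟨Eqv.refl, Eqv.symm, Eqv.trans⟩⟩

end Raw

/-- Expressions of the CCV calculus: raw expressions up to syntactic equality. -/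
def Expr (s : Cat) : Type := Quotient (Raw.setoid s)

/-- Terms of the CCV calculus. -/
abbrev Term : Type := Expr .term

/-- One-step reduction of the CCV calculus: a reduction step between some representatives. -/
def Expr.Red {s : Cat} (a b : Expr s) : Prop :=
  ∃ M N : Raw s, Quotient.mk _ M = a ∧ Quotient.mk _ N = b ∧ Raw.Step M N

/-- The four sorts of the target calculus. -/
inductive Srt
  | term
  | jump
  | value
  | cont

/-- The sorted target lambda calculus, as de Bruijn terms:
`T ::= λk.Q | W W`, `Q ::= K W | T K`, `W ::= x | λx.T`, `K ::= k | λx.Q`.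
Ordinary variables (sort `value`) and continuation variables (sort `cont`) have separate index
spaces. -/
inductive Tgt : Srt → Type
  | lamK (Q : Tgt .jump) : Tgt .term
  | appV (W₁ W₂ : Tgt .value) : Tgt .term
  | appK (K : Tgt .cont) (W : Tgt .value) : Tgt .jump
  | appT (T : Tgt .term) (K : Tgt .cont) : Tgt .jump
  | var (x : ℕ) : Tgt .value
  | lamT (T : Tgt .term) : Tgt .value
  | kvar (k : ℕ) : Tgt .cont
  | lamQ (Q : Tgt .jump) : Tgt .cont

namespace Tgt

/-- Rename the free ordinary variables by `ρ` and the free continuation variables by `κ`. -/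
def ren : {s : Srt} → (ρ κ : ℕ → ℕ) → Tgt s → Tgt s
  | _, ρ, κ, lamK Q => lamK (ren ρ (up κ) Q)
  | _, ρ, κ, appV W₁ W₂ => appV (ren ρ κ W₁) (ren ρ κ W₂)
  | _, ρ, κ, appK K W => appK (ren ρ κ K) (ren ρ κ W)
  | _, ρ, κ, appT T K => appT (ren ρ κ T) (ren ρ κ K)
  | _, ρ, _, var x => var (ρ x)
  | _, ρ, κ, lamT T => lamT (ren (up ρ) κ T)
  | _, _, κ, kvar k => kvar (κ k)
  | _, ρ, κ, lamQ Q => lamQ (ren (up ρ) κ Q)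

/-- Weakening by a fresh ordinary variable. -/
def wk {s : Srt} (P : Tgt s) : Tgt s := P.ren Nat.succ id

/-- Weakening by a fresh continuation variable. -/
def wkK {s : Srt} (P : Tgt s) : Tgt s := P.ren id Nat.succ

/-- Capture-avoiding simultaneous substitution of values for ordinary variables and of
continuations for continuation variables. -/
def subst : {s : Srt} → (σ : ℕ → Tgt .value) → (τ : ℕ → Tgt .cont) → Tgt s → Tgt s
  | _, σ, τ, lamK Q =>
      lamK (subst (fun n => (σ n).wkK) (fun n => Nat.casesOn n (kvar 0) fun m => (τ m).wkK) Q)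
  | _, σ, τ, appV W₁ W₂ => appV (subst σ τ W₁) (subst σ τ W₂)
  | _, σ, τ, appK K W => appK (subst σ τ K) (subst σ τ W)
  | _, σ, τ, appT T K => appT (subst σ τ T) (subst σ τ K)
  | _, σ, _, var x => σ x
  | _, σ, τ, lamT T =>
      lamT (subst (fun n => Nat.casesOn n (var 0) fun m => (σ m).wk) (fun n => (τ n).wk) T)
  | _, _, τ, kvar k => τ k
  | _, σ, τ, lamQ Q =>
      lamQ (subst (fun n => Nat.casesOn n (var 0) fun m => (σ m).wk) (fun n => (τ n).wk) Q)

/-- `P{W/x}`, where `x` is the ordinary variable `0` of `P`. -/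
def inst {s : Srt} (P : Tgt s) (W : Tgt .value) : Tgt s :=
  P.subst (fun n => Nat.casesOn n W fun m => var m) kvar

/-- `P{K/k}`, where `k` is the continuation variable `0` of `P`. -/
def instK {s : Srt} (P : Tgt s) (K : Tgt .cont) : Tgt s :=
  P.subst var (fun n => Nat.casesOn n K fun m => kvar m)

/-- One step of `βη`-reduction in the target calculus, in an arbitrary context. -/
inductive Step : {s : Srt} → Tgt s → Tgt s → Prop
  | betaT (T : Tgt .term) (W : Tgt .value) : Step (appV (lamT T) W) (T.inst W)
  | betaQ (Q : Tgt .jump) (W : Tgt .value) : Step (appK (lamQ Q) W) (Q.inst W)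
  | betaK (Q : Tgt .jump) (K : Tgt .cont) : Step (appT (lamK Q) K) (Q.instK K)
  | etaT (T : Tgt .term) : Step (lamK (appT T.wkK (kvar 0))) T
  | etaW (W : Tgt .value) : Step (lamT (appV W.wk (var 0))) W
  | etaK (K : Tgt .cont) : Step (lamQ (appK K.wk (var 0))) K
  | lamK {Q Q' : Tgt .jump} : Step Q Q' → Step (lamK Q) (lamK Q')
  | appVL {W W' : Tgt .value} (U : Tgt .value) : Step W W' → Step (appV W U) (appV W' U)
  | appVR (U : Tgt .value) {W W' : Tgt .value} : Step W W' → Step (appV U W) (appV U W')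
  | appKL {K K' : Tgt .cont} (W : Tgt .value) : Step K K' → Step (appK K W) (appK K' W)
  | appKR (K : Tgt .cont) {W W' : Tgt .value} : Step W W' → Step (appK K W) (appK K W')
  | appTL {T T' : Tgt .term} (K : Tgt .cont) : Step T T' → Step (appT T K) (appT T' K)
  | appTR (T : Tgt .term) {K K' : Tgt .cont} : Step K K' → Step (appT T K) (appT T K')
  | lamT {T T' : Tgt .term} : Step T T' → Step (lamT T) (lamT T')
  | lamQ {Q Q' : Tgt .jump} : Step Q Q' → Step (lamQ Q) (lamQ Q')

end Tgt

namespace Raw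

/-- A term is translated relative to a continuation, a jump is translated outright. -/
def Out : Cat → Type
  | .term => Tgt .cont → Tgt .jump
  | .jump => Tgt .jump

mutual

/-- The colon translation `⟨M⟩[K]` of terms and `⟨J⟩` of jumps.  To keep the recursion
structural, the free variables of the source are renamed along the way: `colon ρ κ M` is the
colon translation of `M.ren ρ κ`; see `colon_eq_cln`, and the equations `val_var`, ...,
`clnJ_let` for the usual form of the definition. -/
def colon : {s : Cat} → (ρ κ : ℕ → ℕ) → Raw s → Out s
  | _, ρ, _, var x => fun K => .appK K (.var (ρ x))
  | _, ρ, κ, lam M => fun K =>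
      .appK K (.lamT (.lamK (colon (up ρ) (fun n => κ n + 1) M (.kvar 0))))
  | _, ρ, κ, app M N => fun K =>
      match M.isValue, N.isValue with
      | true, true => .appT (.appV (star ρ κ M) (star ρ κ N)) K
      | true, false =>
          colon ρ κ N (.lamQ (.appT (.appV (star ρ κ M).wk (.var 0)) K.wk))
      | false, true =>
          colon ρ κ M (.lamQ (.appT (.appV (.var 0) (star ρ κ N).wk) K.wk))
      | false, false =>
          colon ρ κ M (.lamQ (colon (fun n => ρ n + 1) κ N
            (.lamQ (.appT (.appV (.var 1) (.var 0)) K.wk.wk))))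
  | _, ρ, κ, mu J => fun K => .appT (.lamK (colon ρ (up κ) J)) K
  | _, ρ, κ, jmp k M => colon ρ κ M (.kvar (κ k))
  | .term, ρ, κ, letE L M => fun K => colon ρ κ M (.lamQ (colon (up ρ) κ L K.wk))
  | .jump, ρ, κ, letE J M => colon ρ κ M (.lamQ (colon (up ρ) κ J))

/-- The translation `V*` of values (with an irrelevant result on all other expressions). -/
def star : {s : Cat} → (ρ κ : ℕ → ℕ) → Raw s → Tgt .value
  | _, ρ, _, var x => .var (ρ x)
  | _, ρ, κ, lam M => .lamT (.lamK (colon (up ρ) (fun n => κ n + 1) M (.kvar 0)))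
  | _, _, _, _ => .var 0

end

end Raw

theorem up_comp (ρ ρ' : ℕ → ℕ) : up ρ ∘ up ρ' = up (ρ ∘ ρ') := by
  funext n; cases n <;> rfl

theorem up_id : up id = id := by
  funext n; cases n <;> rfl

theorem Tgt.ren_ren {s : Srt} (P : Tgt s) (ρ κ ρ' κ' : ℕ → ℕ) :
    (P.ren ρ κ).ren ρ' κ' = P.ren (ρ' ∘ ρ) (κ' ∘ κ) := by
  induction P generalizing ρ κ ρ' κ' <;> simp_all [Tgt.ren, up_comp]

theorem Tgt.ren_wk {s : Srt} (P : Tgt s) (ρ κ : ℕ → ℕ) :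
    P.wk.ren (up ρ) κ = (P.ren ρ κ).wk := by
  simp only [Tgt.wk, Tgt.ren_ren]; rfl

namespace Raw

theorem isValue_ren {s : Cat} (M : Raw s) (ρ κ : ℕ → ℕ) : (M.ren ρ κ).isValue = M.isValue := by
  cases M <;> rfl

/-- Renaming before the translation. -/
theorem colon_ren {s : Cat} (M : Raw s) (ρ κ ρ' κ' : ℕ → ℕ) :
    colon ρ κ (M.ren ρ' κ') = colon (ρ ∘ ρ') (κ ∘ κ') M ∧
      star ρ κ (M.ren ρ' κ') = star (ρ ∘ ρ') (κ ∘ κ') M := by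
  induction M generalizing ρ κ ρ' κ' with
  | var x => exact ⟨rfl, rfl⟩
  | lam M ih =>
    have h := (ih (up ρ) (fun n => κ n + 1) (up ρ') κ').1
    rw [up_comp] at h
    constructor <;> simp only [ren, colon, star, h] <;> rfl
  | app M N ihM ihN =>
    refine ⟨?_, rfl⟩
    funext K
    simp only [ren, colon, isValue_ren, ihM, ihN]
    rfl
  | mu J ih =>
    refine ⟨?_, rfl⟩
    simp only [ren, colon, ih, up_comp]; rfl
  | jmp k M ih =>
    refine ⟨?_, rfl⟩
    simp only [ren, colon, ih]; rfl
  | @letE s M N ihM ihN =>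
    cases s <;> refine ⟨?_, rfl⟩ <;> simp only [ren, colon, ihM, ihN, up_comp] <;> rfl

/-- Renaming of the result of a translation. -/
def RenOut : (s : Cat) → (ρ κ : ℕ → ℕ) → Out s → Out s → Prop
  | .term, ρ, κ, F, G => ∀ K : Tgt .cont, (F K).ren ρ κ = G (K.ren ρ κ)
  | .jump, ρ, κ, Q, R => Tgt.ren ρ κ Q = R

/-- Renaming after the translation. -/
theorem ren_colon {s : Cat} (M : Raw s) (ρ κ ρ' κ' : ℕ → ℕ) :
    RenOut s ρ' κ' (colon ρ κ M) (colon (ρ' ∘ ρ) (κ' ∘ κ) M) ∧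
      (star ρ κ M).ren ρ' κ' = if M.isValue then star (ρ' ∘ ρ) (κ' ∘ κ) M else .var (ρ' 0) := by
  induction M generalizing ρ κ ρ' κ' with
  | var x => exact ⟨fun K => rfl, rfl⟩
  | lam M ih =>
    have h := (ih (up ρ) (fun n => κ n + 1) (up ρ') (up κ')).1 (.kvar 0)
    rw [up_comp] at h
    constructor
    · intro K
      simp only [colon, Tgt.ren, h]; rfl
    · simp only [star, Tgt.ren, h, isValue]; rfl
  | app M N ihM ihN =>
    refine ⟨fun K => ?_, rfl⟩
    have hM := fun ρ κ ρ' κ' => (ihM ρ κ ρ' κ').1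
    have hN := fun ρ κ ρ' κ' => (ihN ρ κ ρ' κ').1
    have sM := fun ρ κ ρ' κ' => (ihM ρ κ ρ' κ').2
    have sN := fun ρ κ ρ' κ' => (ihN ρ κ ρ' κ').2
    simp only [RenOut] at hM hN
    cases h₁ : M.isValue <;> cases h₂ : N.isValue <;>
      simp only [colon, h₁, h₂, Tgt.ren, hM, hN, Tgt.ren_wk, sM, sN, if_true] <;> rfl
  | mu J ih =>
    refine ⟨fun K => ?_, rfl⟩
    have h := (ih ρ (up κ) ρ' (up κ')).1
    rw [up_comp] at h
    simp only [RenOut] at h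
    simp only [colon, Tgt.ren, h]
  | jmp k M ih =>
    exact ⟨(ih ρ κ ρ' κ').1 (.kvar (κ k)), rfl⟩
  | @letE s M N ihM ihN =>
    have hM := (ihM (up ρ) κ (up ρ') κ').1
    have hN := (ihN ρ κ ρ' κ').1
    rw [up_comp] at hM
    cases s
    · refine ⟨fun K => ?_, rfl⟩
      simp only [RenOut] at hM hN
      simp only [colon, hN, Tgt.ren, hM, Tgt.ren_wk]
    · refine ⟨?_, rfl⟩
      simp only [RenOut] at hM hN ⊢
      simp only [colon, hN, Tgt.ren, hM]

/-- The translation respects syntactic equality. -/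
theorem colon_eqv {s : Cat} {M N : Raw s} (h : Eqv M N) (ρ κ : ℕ → ℕ) :
    colon ρ κ M = colon ρ κ N ∧ star ρ κ M = star ρ κ N ∧ M.isValue = N.isValue := by
  induction h generalizing ρ κ with
  | assoc L M N =>
    refine ⟨?_, rfl, rfl⟩
    funext K
    have h := (ren_colon M (up ρ) κ (up Nat.succ) id).1
    have hL := (ren_colon L (up ρ) κ (up Nat.succ) id).1 K.wk
    simp only [colon, wkUnder, colon_ren, Tgt.wk, Tgt.ren, up_comp] at hL ⊢
    rw [hL, Tgt.ren_ren, Tgt.ren_ren]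
    rfl
  | jmpAssoc k L M => exact ⟨rfl, rfl, rfl⟩
  | refl M => exact ⟨rfl, rfl, rfl⟩
  | symm _ ih => exact ⟨(ih ρ κ).1.symm, (ih ρ κ).2.1.symm, (ih ρ κ).2.2.symm⟩
  | trans _ _ ih₁ ih₂ =>
    exact ⟨(ih₁ ρ κ).1.trans (ih₂ ρ κ).1, (ih₁ ρ κ).2.1.trans (ih₂ ρ κ).2.1,
      (ih₁ ρ κ).2.2.trans (ih₂ ρ κ).2.2⟩
  | lam _ ih =>
    have h := (ih (up ρ) (fun n => κ n + 1)).1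
    exact ⟨by simp only [colon, h]; rfl, by simp only [star, h], rfl⟩
  | app _ _ ihM ihN =>
    refine ⟨?_, rfl, rfl⟩
    simp only [colon, fun ρ κ => (ihM ρ κ).1, fun ρ κ => (ihN ρ κ).1,
      fun ρ κ => (ihM ρ κ).2.1, fun ρ κ => (ihN ρ κ).2.1, (ihM id id).2.2, (ihN id id).2.2]; rfl
  | mu _ ih => exact ⟨by simp only [colon, (ih ρ (up κ)).1]; rfl, rfl, rfl⟩
  | jmp k _ ih => exact ⟨by simp only [colon, (ih ρ κ).1]; rfl, rfl, rfl⟩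
  | @letE s _ _ _ _ _ _ ihM ihN =>
    cases s <;> exact ⟨by simp only [colon, (ihM (up ρ) κ).1, (ihN ρ κ).1]; rfl, rfl, rfl⟩

/-- `⟨M⟩[K]` for a term `M`. -/
def cln (M : Raw .term) (K : Tgt .cont) : Tgt .jump := colon id id M K

/-- `⟨J⟩` for a jump `J`. -/
def clnJ (J : Raw .jump) : Tgt .jump := colon id id J

/-- `V*` for a value `V`. -/
def val (V : Raw .term) : Tgt .value := star id id V

/-- `[[M]] = λk.⟨M⟩[k]`, with `k` fresh. -/
def cps (M : Raw .term) : Tgt .term := .lamK (cln M.wkK (.kvar 0))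

theorem colon_eq_cln (M : Raw .term) (ρ κ : ℕ → ℕ) (K : Tgt .cont) :
    colon ρ κ M K = cln (M.ren ρ κ) K := by
  rw [cln, (colon_ren M id id ρ κ).1]; rfl

theorem colon_eq_clnJ (J : Raw .jump) (ρ κ : ℕ → ℕ) : colon ρ κ J = clnJ (J.ren ρ κ) := by
  rw [clnJ, (colon_ren J id id ρ κ).1]; rfl

/-! The defining equations of the colon translation. -/

theorem val_var (x : ℕ) : val (var x) = .var x := rfl

theorem val_lam (M : Raw .term) : val (lam M) = .lamT (cps M) := by
  simp only [val, star, cps, cln, wkK, colon_ren, up_id]; rfl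

theorem cln_value (V : Raw .term) (hV : V.isValue = true) (K : Tgt .cont) :
    cln V K = .appK K (val V) := by
  cases V <;> first | rfl | simp [isValue] at hV

theorem cln_app_VV (V₁ V₂ : Raw .term) (h₁ : V₁.isValue = true) (h₂ : V₂.isValue = true)
    (K : Tgt .cont) : cln (app V₁ V₂) K = .appT (.appV (val V₁) (val V₂)) K := by
  simp only [cln, colon, h₁, h₂]; rfl

theorem cln_app_VN (V N : Raw .term) (h₁ : V.isValue = true) (h₂ : N.isValue = false)
    (K : Tgt .cont) :
    cln (app V N) K = cln N (.lamQ (.appT (.appV (val V).wk (.var 0)) K.wk)) := by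
  simp only [cln, colon, h₁, h₂]; rfl

theorem cln_app_NV (N V : Raw .term) (h₁ : N.isValue = false) (h₂ : V.isValue = true)
    (K : Tgt .cont) :
    cln (app N V) K = cln N (.lamQ (.appT (.appV (.var 0) (val V).wk) K.wk)) := by
  simp only [cln, colon, h₁, h₂]; rfl

theorem cln_app_NN (N₁ N₂ : Raw .term) (h₁ : N₁.isValue = false) (h₂ : N₂.isValue = false)
    (K : Tgt .cont) :
    cln (app N₁ N₂) K =
      cln N₁ (.lamQ (cln N₂.wk (.lamQ (.appT (.appV (.var 1) (.var 0)) K.wk.wk)))) := by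
  simp only [cln, colon, h₁, h₂, wk, colon_ren]; rfl

theorem cln_let (L M : Raw .term) (K : Tgt .cont) :
    cln (letE L M) K = cln M (.lamQ (cln L K.wk)) := by
  simp only [cln, colon, up_id]

theorem cln_mu (J : Raw .jump) (K : Tgt .cont) : cln (mu J) K = .appT (.lamK (clnJ J)) K := by
  simp only [cln, clnJ, colon, up_id]

theorem clnJ_jmp (k : ℕ) (M : Raw .term) : clnJ (jmp k M) = cln M (.kvar k) := rfl

theorem clnJ_let (J : Raw .jump) (M : Raw .term) : clnJ (letE J M) = cln M (.lamQ (clnJ J)) := by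
  simp only [cln, clnJ, colon, up_id]

theorem cps_eqv {M N : Raw .term} (h : Eqv M N) : cps M = cps N := by
  simp only [cps, cln, wkK, colon_ren, (colon_eqv h _ _).1]

end Raw

/-- The CPS translation `[[M]]` of a CCV term. -/
def Term.cps (M : Term) : Tgt .term :=
  Quotient.lift Raw.cps (fun _ _ h => Raw.cps_eqv h) M

end CCV

-- The proof reads target terms back as source expressions and simulates target reduction in the
-- source. Continuations `K` become `[k]□` or `J⌈x := □⌉`, the jumps `K W` and `T K` become fillings
-- of these holes, and `λk.Q` becomes `μk.J`. Since `[[M]]` is `λk.⟨M⟩[k]` although `M` itself need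
-- not be a `μ`, the abstraction `λk.Q` may also be read as `M` whenever `J` equals `[k]M` with `k`
-- not free in `M`. The reading `Rel` is therefore a relation, not a function. It is compatible with
-- renaming and substitution (`Rel.subst`), and it relates `[[M]]` to `M.nameArgs`, the reduct of
-- `M` in which every non-value argument or operator has been named by a let (`Raw.rel_cps`,
-- `Raw.reds_nameArgs`).
--
-- By `Rel.sim`, a target step is matched by at least one source step, or by any number of them,
-- possibly none, while the target size drops. A size drop is used only for administrative steps:
-- substituting a continuation variable for `k` in `λk.Q`, β at a contracted `μ` (where `k` occurs
-- exactly once), and η at a contracted `μ`. Strong normalization of the source and the size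
-- together give a lexicographic induction (`Rel.acc`).
--
-- The delicate point is a step inside `Q` when `λk.Q` is read as the contracted term `M`. A source
-- step `[k]μl.E → E{k/l}` may then be no step at all: `M` is `μl.E`, which is also `μk.E{k/l}`. So
-- only proper reductions of the term passed to the head of a jump are counted. `JumpSim` records
-- this, and `Raw.Reds.of_jmp_wkK` carries it over to `M`. Every jump equals some `[k]M`
-- (`Raw.eqv_jmp_head_body`), so this makes sense for all jumps.

namespace CCV

-- Source continuations and simultaneous substitution

/-- Continuations of the source calculus: `[k]□`, or `J⌈x := □⌉` with `x` the variable `0` of `J`. -/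
inductive Ctx
  | kvar (k : ℕ)
  | bind (J : Raw .jump)

namespace Ctx

/-- Fill the hole of a continuation. -/
def plug : Ctx → Raw .term → Raw .jump
  | kvar k, P => .jmp k P
  | bind J, P => .letE J P

/-- Rename the free variables of a continuation. -/
def ren (ρ κ : ℕ → ℕ) : Ctx → Ctx
  | kvar k => kvar (κ k)
  | bind J => bind (J.ren (up ρ) κ)

theorem plug_ren (C : Ctx) (P : Raw .term) (ρ κ : ℕ → ℕ) :
    (C.plug P).ren ρ κ = (C.ren ρ κ).plug (P.ren ρ κ) := by
  cases C <;> rfl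

end Ctx

namespace Raw

theorem ren_ren {s : Cat} (M : Raw s) (ρ κ ρ' κ' : ℕ → ℕ) :
    (M.ren ρ κ).ren ρ' κ' = M.ren (ρ' ∘ ρ) (κ' ∘ κ) := by
  induction M generalizing ρ κ ρ' κ' <;> simp_all [ren, up_comp]

theorem ren_id {s : Cat} (M : Raw s) : M.ren id id = M := by
  induction M <;> simp_all [ren, up_id]

theorem wk_ren {s : Cat} (M : Raw s) (ρ κ : ℕ → ℕ) :
    M.wk.ren (up ρ) κ = (M.ren ρ κ).wk := by
  simp only [wk, ren_ren]; rfl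

theorem wkK_ren {s : Cat} (M : Raw s) (ρ κ : ℕ → ℕ) :
    M.wkK.ren ρ (up κ) = (M.ren ρ κ).wkK := by
  simp only [wkK, ren_ren]; rfl

theorem wkUnder_ren {s : Cat} (M : Raw s) (ρ κ : ℕ → ℕ) :
    M.wkUnder.ren (up (up ρ)) κ = (M.ren (up ρ) κ).wkUnder := by
  simp only [wkUnder, ren_ren, up_comp]; rfl

end Raw

theorem Ctx.ren_ren (C : Ctx) (ρ κ ρ' κ' : ℕ → ℕ) :
    (C.ren ρ κ).ren ρ' κ' = C.ren (ρ' ∘ ρ) (κ' ∘ κ) := by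
  cases C <;> simp [Ctx.ren, Raw.ren_ren, up_comp]

namespace Raw

/-- Extension of a substitution under an ordinary binder. -/
def liftV (σ : ℕ → Raw .term) : ℕ → Raw .term
  | 0 => var 0
  | n + 1 => (σ n).wk

/-- Extension of a substitution of continuations under a continuation binder. -/
def liftC (τ : ℕ → Ctx) : ℕ → Ctx
  | 0 => .kvar 0
  | n + 1 => (τ n).ren id Nat.succ

/-- Simultaneous substitution of terms for the ordinary variables and of continuations for the
continuation variables. -/
def rsub : {s : Cat} → (σ : ℕ → Raw .term) → (τ : ℕ → Ctx) → Raw s → Raw s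
  | _, σ, _, var x => σ x
  | _, σ, τ, lam M => lam (rsub (liftV σ) (fun n => (τ n).ren Nat.succ id) M)
  | _, σ, τ, app M N => app (rsub σ τ M) (rsub σ τ N)
  | _, σ, τ, mu J => mu (rsub (fun n => (σ n).wkK) (liftC τ) J)
  | _, σ, τ, jmp k M => (τ k).plug (rsub σ τ M)
  | _, σ, τ, letE M N =>
      letE (rsub (liftV σ) (fun n => (τ n).ren Nat.succ id) M) (rsub σ τ N)

theorem liftV_comp_up (σ : ℕ → Raw .term) (ρ : ℕ → ℕ) : liftV σ ∘ up ρ = liftV (σ ∘ ρ) := by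
  funext n; cases n <;> rfl

theorem liftC_comp_up (τ : ℕ → Ctx) (κ : ℕ → ℕ) : liftC τ ∘ up κ = liftC (τ ∘ κ) := by
  funext n; cases n <;> rfl

theorem ren_liftV (σ : ℕ → Raw .term) (ρ κ : ℕ → ℕ) :
    (fun n => (liftV σ n).ren (up ρ) κ) = liftV fun n => (σ n).ren ρ κ := by
  funext n
  cases n with
  | zero => rfl
  | succ n => exact wk_ren _ _ _

theorem ren_liftC (τ : ℕ → Ctx) (ρ κ : ℕ → ℕ) :
    (fun n => (liftC τ n).ren ρ (up κ)) = liftC fun n => (τ n).ren ρ κ := by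
  funext n
  cases n with
  | zero => rfl
  | succ n => simp only [liftC, Ctx.ren_ren]; rfl

theorem rsub_ren {s : Cat} (M : Raw s) (σ : ℕ → Raw .term) (τ : ℕ → Ctx) (ρ κ : ℕ → ℕ) :
    rsub σ τ (M.ren ρ κ) = rsub (σ ∘ ρ) (τ ∘ κ) M := by
  induction M generalizing σ τ ρ κ <;> simp_all only [ren, rsub, liftV_comp_up, liftC_comp_up] <;> rfl

theorem ren_rsub {s : Cat} (M : Raw s) (σ : ℕ → Raw .term) (τ : ℕ → Ctx) (ρ κ : ℕ → ℕ) :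
    (rsub σ τ M).ren ρ κ = rsub (fun n => (σ n).ren ρ κ) (fun n => (τ n).ren ρ κ) M := by
  induction M generalizing σ τ ρ κ with
  | var x => rfl
  | lam M ih => simp only [ren, rsub, ih, ren_liftV, Ctx.ren_ren]; rfl
  | app M N ihM ihN => simp only [ren, rsub, ihM, ihN]
  | mu J ih => simp only [ren, rsub, ih, ren_liftC, wkK_ren]
  | jmp k M ih => simp only [rsub, Ctx.plug_ren, ih]
  | letE M N ihM ihN => simp only [ren, rsub, ihM, ihN, ren_liftV, Ctx.ren_ren]; rfl

theorem ren_eq_rsub {s : Cat} (M : Raw s) (ρ κ : ℕ → ℕ) :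
    M.ren ρ κ = rsub (fun n => var (ρ n)) (fun n => .kvar (κ n)) M := by
  induction M generalizing ρ κ with
  | var x => rfl
  | lam M ih =>
    simp only [ren, rsub, ih]; congr 2; funext n; cases n <;> rfl
  | app M N ihM ihN => simp only [ren, rsub, ihM, ihN]
  | mu J ih =>
    simp only [ren, rsub, ih]; congr 2; funext n; cases n <;> rfl
  | jmp k M ih => simp only [ren, rsub, ih]; rfl
  | letE M N ihM ihN =>
    simp only [ren, rsub, ihM, ihN]; congr 2; funext n; cases n <;> rfl

theorem rsub_id {s : Cat} (M : Raw s) : rsub var .kvar M = M := by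
  rw [← ren_eq_rsub M (fun n => n) (fun n => n)]; exact ren_id M

theorem subst_eq_rsub {s : Cat} (M : Raw s) (σ : ℕ → Raw .term) :
    M.subst σ = rsub σ .kvar M := by
  induction M generalizing σ with
  | var x => rfl
  | lam M ih =>
    simp only [subst, rsub, ih]; congr 2; funext n; cases n <;> rfl
  | app M N ihM ihN => simp only [subst, rsub, ihM, ihN]
  | mu J ih =>
    simp only [subst, rsub, ih]; congr 2; funext n; cases n <;> rfl
  | jmp k M ih => simp only [subst, rsub, ih]; rfl
  | letE M N ihM ihN =>
    simp only [subst, rsub, ihM, ihN]; congr 2; funext n; cases n <;> rfl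

/-- Extension of a substitution by an image for the variable `0`. -/
def cons {α : Type} (a : α) (f : ℕ → α) : ℕ → α
  | 0 => a
  | n + 1 => f n

theorem inst_eq_rsub {s : Cat} (M : Raw s) (V : Raw .term) :
    M.inst V = rsub (cons V var) .kvar M := by
  rw [inst, subst_eq_rsub]; congr 1; funext n; cases n <;> rfl

theorem instK_eq_rsub (J : Raw .jump) (l : ℕ) :
    J.instK l = rsub var (cons (.kvar l) .kvar) J := by
  rw [instK, ren_eq_rsub]; congr 1; funext n; cases n <;> rfl

theorem inst_ren {s : Cat} (M : Raw s) (V : Raw .term) (ρ κ : ℕ → ℕ) :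
    (M.inst V).ren ρ κ = (M.ren (up ρ) κ).inst (V.ren ρ κ) := by
  simp only [inst_eq_rsub, ren_rsub, rsub_ren]
  congr 1; funext n; cases n <;> rfl

theorem instK_ren (J : Raw .jump) (l : ℕ) (ρ κ : ℕ → ℕ) :
    (J.instK l).ren ρ κ = (J.ren ρ (up κ)).instK (κ l) := by
  simp only [instK, ren_ren]; congr 1; funext n; cases n <;> rfl

theorem wkK_rsub_cons {s : Cat} (M : Raw s) (C : Ctx) (τ : ℕ → Ctx) (σ : ℕ → Raw .term) :
    rsub σ (cons C τ) M.wkK = rsub σ τ M := by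
  rw [wkK, rsub_ren]; rfl

theorem wkUnder_inst_var {s : Cat} (M : Raw s) : M.wkUnder.inst (var 0) = M := by
  rw [inst_eq_rsub, wkUnder, rsub_ren]
  conv_rhs => rw [← rsub_id M]
  congr 1; funext n; cases n <;> rfl

theorem letE_instK (J : Raw .jump) (P : Raw .term) (l : ℕ) :
    (letE J P.wkK).instK l = letE (J.instK l) P := by
  have h : P.wkK.ren id (fun n => Nat.casesOn n l fun m => m) = P := by
    rw [wkK, ren_ren]; exact ren_id P
  simp only [instK, ren, up_id, h]

/-- Binders move across one another only in `assoc`, where the weakening under a binder commutes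
with the lifted renaming. -/
theorem Eqv.ren {s : Cat} {M N : Raw s} (h : Eqv M N) (ρ κ : ℕ → ℕ) :
    Eqv (M.ren ρ κ) (N.ren ρ κ) := by
  induction h generalizing ρ κ with
  | assoc L M N => simp only [Raw.ren, wkUnder_ren]; exact .assoc _ _ _
  | jmpAssoc k L M => exact .jmpAssoc _ _ _
  | refl M => exact .refl _
  | symm _ ih => exact (ih ρ κ).symm
  | trans _ _ ih₁ ih₂ => exact (ih₁ ρ κ).trans (ih₂ ρ κ)
  | lam _ ih => exact .lam (ih _ _)
  | app _ _ ihM ihN => exact .app (ihM _ _) (ihN _ _)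
  | mu _ ih => exact .mu (ih _ _)
  | jmp k _ ih => exact .jmp _ (ih _ _)
  | letE _ _ ihM ihN => exact .letE (ihM _ _) (ihN _ _)

-- Syntactic equality, and the form `[k]M` of a jump

/-- The continuation variable to which a jump passes control. -/
def head : {s : Cat} → Raw s → ℕ
  | _, jmp k _ => k
  | _, letE J _ => head J
  | _, _ => 0

/-- The term which a jump passes to its head. -/
def body : {s : Cat} → Raw s → Raw .term
  | _, jmp _ M => M
  | _, letE J P => letE (body J) P
  | _, _ => var 0

/-- All lets around a jump can be pushed inside it by `jmpAssoc`. The inner statement ranges over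
both categories only because the induction on `Raw` does. -/
theorem eqv_jmp_head_body (J : Raw .jump) : Eqv J (jmp J.head J.body) := by
  have h : ∀ {s : Cat} (J : Raw s), match s, J with
      | .term, _ => True
      | .jump, J => Eqv J (jmp J.head J.body) := by
    intro s J
    induction J with
    | jmp k M => exact .refl _
    | @letE s J P ih =>
      cases s
      · trivial
      · exact (Eqv.letE ih (.refl P)).trans (.symm (.jmpAssoc _ _ _))
    | _ => trivial
  exact h J

/-- Agreement of head and body, for jumps. -/
def HeadBodyEqv : (s : Cat) → Raw s → Raw s → Prop
  | .term, _, _ => True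
  | .jump, M, N => M.head = N.head ∧ Eqv M.body N.body

/-- The axiom `jmpAssoc` leaves head and body literally unchanged, and `assoc` concerns terms only;
hence both are invariants of a jump, and `jmp k` is injective up to syntactic equality. -/
theorem Eqv.head_body {s : Cat} {M N : Raw s} (h : Eqv M N) : HeadBodyEqv s M N := by
  induction h with
  | jmpAssoc k L M => exact ⟨rfl, .refl _⟩
  | @refl s M => cases s; exacts [trivial, ⟨rfl, .refl _⟩]
  | @symm s _ _ _ ih => cases s; exacts [trivial, ⟨ih.1.symm, ih.2.symm⟩]
  | @trans s _ _ _ _ _ ih₁ ih₂ =>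
    cases s; exacts [trivial, ⟨ih₁.1.trans ih₂.1, ih₁.2.trans ih₂.2⟩]
  | jmp k h _ => exact ⟨rfl, h⟩
  | @letE s _ _ _ _ _ h ihM _ => cases s; exacts [trivial, ⟨ihM.1, .letE ihM.2 h⟩]
  | _ => trivial

theorem Eqv.jmp_inj {k l : ℕ} {M N : Raw .term} (h : Eqv (.jmp k M) (.jmp l N)) :
    k = l ∧ Eqv M N :=
  h.head_body

/-- The axiom is stated for terms. For a jump, write it as `[k]L`, move both lets inside,
reassociate there, and move them out again. -/
theorem Eqv.assocJ (J : Raw .jump) (M N : Raw .term) :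
    Eqv (.letE J (.letE M N)) (.letE (.letE J.wkUnder M) N) := by
  have h := eqv_jmp_head_body J
  refine (Eqv.letE h (.refl _)).trans ((Eqv.jmpAssoc _ _ _).symm.trans ?_)
  refine (Eqv.jmp _ (.assoc _ _ _)).trans ((Eqv.jmpAssoc _ _ _).trans ?_)
  exact .letE ((Eqv.jmpAssoc _ _ _).trans (.letE (h.ren (up Nat.succ) id).symm (.refl _))) (.refl _)

theorem Eqv.plug_let (C : Ctx) (M N : Raw .term) :
    Eqv (C.plug (.letE M N)) (.letE ((C.ren Nat.succ id).plug M) N) := by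
  cases C with
  | kvar k => exact .jmpAssoc _ _ _
  | bind J => exact .assocJ _ _ _

theorem Eqv.plug (C : Ctx) {M N : Raw .term} (h : Eqv M N) : Eqv (C.plug M) (C.plug N) := by
  cases C with
  | kvar k => exact .jmp _ h
  | bind J => exact .letE (.refl _) h

theorem rsub_wkUnder {s : Cat} (L : Raw s) (σ : ℕ → Raw .term) (τ : ℕ → Ctx) :
    rsub (liftV (liftV σ)) (fun n => ((τ n).ren Nat.succ id).ren Nat.succ id) L.wkUnder =
      (rsub (liftV σ) (fun n => (τ n).ren Nat.succ id) L).wkUnder := by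
  rw [wkUnder, wkUnder, rsub_ren, ren_rsub]
  congr 1
  · funext n
    cases n with
    | zero => rfl
    | succ n => simp only [Function.comp, up, liftV, wk, ren_ren]; rfl
  · funext n; simp only [Ctx.ren_ren, Function.comp]; rfl

/-- Substituting a continuation turns `jmpAssoc` into `Eqv.plug_let`; this is where associativity
for jumps is needed. -/
theorem Eqv.rsub {s : Cat} {M N : Raw s} (h : Eqv M N) (σ : ℕ → Raw .term) (τ : ℕ → Ctx) :
    Eqv (M.rsub σ τ) (N.rsub σ τ) := by
  induction h generalizing σ τ with
  | assoc L M N => simp only [Raw.rsub, rsub_wkUnder]; exact .assoc _ _ _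
  | jmpAssoc k L M => exact .plug_let _ _ _
  | refl M => exact .refl _
  | symm _ ih => exact (ih σ τ).symm
  | trans _ _ ih₁ ih₂ => exact (ih₁ σ τ).trans (ih₂ σ τ)
  | lam _ ih => exact .lam (ih _ _)
  | app _ _ ihM ihN => exact .app (ihM _ _) (ihN _ _)
  | mu _ ih => exact .mu (ih _ _)
  | jmp k _ ih => exact .plug _ (ih _ _)
  | letE _ _ ihM ihN => exact .letE (ihM _ _) (ihN _ _)

/-- Context substitution compares names with `k`, so the renaming must not identify another variable
with `k`. -/
theorem ctxSubst_ren {s : Cat} (E : Raw s) (k : ℕ) (M : Raw .term) (ρ κ : ℕ → ℕ)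
    (hκ : ∀ j, κ j = κ k → j = k) :
    (ctxSubst k M E).ren ρ κ = ctxSubst (κ k) (M.ren (up ρ) κ) (E.ren ρ κ) := by
  induction E generalizing k M ρ κ with
  | var x => rfl
  | lam P ih => simp only [ctxSubst, ren, ih _ _ _ _ hκ, wkUnder_ren]
  | app P Q ihP ihQ => simp only [ctxSubst, ren, ihP _ _ _ _ hκ, ihQ _ _ _ _ hκ]
  | mu J ih =>
    have h : ∀ j, up κ j = up κ (k + 1) → j = k + 1 := fun j hj => by
      cases j with
      | zero => simp [up] at hj
      | succ j => simpa [up] using hκ j (by simpa [up] using hj)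
    simp only [ctxSubst, ren, ih _ _ _ _ h, wkK_ren]; rfl
  | jmp l P ih =>
    by_cases hl : l = k
    · subst hl; simp only [ctxSubst, ren, if_true, ih _ _ _ _ hκ]
    · have : κ l ≠ κ k := fun h => hl (hκ l h)
      simp only [ctxSubst, ren, if_neg hl, if_neg this, ih _ _ _ _ hκ]
  | letE P Q ihP ihQ =>
    simp only [ctxSubst, ren, ihP _ _ _ _ hκ, ihQ _ _ _ _ hκ, wkUnder_ren]

theorem Eqv.wkUnder_jmp {D : Raw .jump} {k : ℕ} {M : Raw .term} {κ : ℕ → ℕ}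
    (h : Eqv D (.jmp k (M.ren id κ))) : Eqv D.wkUnder (.jmp k (M.wkUnder.ren id κ)) := by
  have e : M.wkUnder.ren id κ = (M.ren id κ).wkUnder := by simp only [wkUnder, ren_ren]; rfl
  rw [e]
  exact h.ren (up Nat.succ) id

/-- The context substitution followed by a renaming is a substitution of a continuation. -/
theorem ctxSubst_ren_eqv {s : Cat} (E : Raw s) (k : ℕ) (M : Raw .term) (κ : ℕ → ℕ) (τ : ℕ → Ctx)
    (D : Raw .jump) (hk : τ k = .bind D) (hD : Eqv D (jmp (κ k) (M.ren id κ)))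
    (hτ : ∀ j, j ≠ k → τ j = .kvar (κ j)) :
    Eqv ((ctxSubst k M E).ren id κ) (rsub var τ E) := by
  have hV : liftV var = var := by funext n; cases n <;> rfl
  induction E generalizing k M κ τ D with
  | var x => exact .refl _
  | lam P ih =>
    simp only [ctxSubst, ren, rsub, up_id, hV]
    exact .lam (ih _ _ _ _ D.wkUnder (by rw [hk]; rfl) hD.wkUnder_jmp
      fun j hj => by rw [hτ j hj]; rfl)
  | app P Q ihP ihQ => exact .app (ihP _ _ _ _ D hk hD hτ) (ihQ _ _ _ _ D hk hD hτ)
  | mu J ih =>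
    simp only [ctxSubst, ren, rsub]
    refine .mu (ih _ _ _ _ D.wkK ?_ ?_ ?_)
    · rw [liftC, hk]; simp only [Ctx.ren, up_id]; rfl
    · rw [wkK_ren]; exact hD.ren id Nat.succ
    · rintro (_ | j) hj
      · rfl
      · rw [liftC, hτ j (by omega)]; rfl
  | jmp l P ih =>
    by_cases hl : l = k
    · subst hl
      simp only [ctxSubst, if_true, ren, rsub, hk, Ctx.plug, up_id]
      -- `ctxSubst` places the let under the jump, whereas filling the hole of `D` places it
      -- outside; `jmpAssoc` identifies the two.
      exact (Eqv.jmpAssoc _ _ _).trans (.letE hD.symm (ih _ _ _ _ D hk hD hτ))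
    · simp only [ctxSubst, if_neg hl, ren, rsub, hτ l hl, Ctx.plug]
      exact .jmp _ (ih _ _ _ _ D hk hD hτ)
  | letE P Q ihP ihQ =>
    simp only [ctxSubst, ren, rsub, up_id, hV]
    exact .letE (ihP _ _ _ _ D.wkUnder (by rw [hk]; rfl) hD.wkUnder_jmp
      fun j hj => by rw [hτ j hj]; rfl) (ihQ _ _ _ _ D hk hD hτ)

theorem Step.ren {s : Cat} {M N : Raw s} (h : Step M N) (ρ κ : ℕ → ℕ) :
    Step (M.ren ρ κ) (N.ren ρ κ) := by
  induction h generalizing ρ κ with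
  | ad₁ N M h => simp only [Raw.ren, wk_ren]; exact .ad₁ _ _ (by rwa [isValue_ren])
  | ad₂ V N h h' =>
    simp only [Raw.ren, wk_ren]; exact .ad₂ _ _ (by rwa [isValue_ren]) (by rwa [isValue_ren])
  | betaLam M V h => exact .betaLam _ _ (by rwa [isValue_ren])
  | betaLet M V h => rw [inst_ren]; exact .betaLet _ _ (by rwa [isValue_ren])
  | betaMu M J =>
    have h : ∀ j, up κ j = up κ 0 → j = 0 := by rintro (_ | j) h <;> simp [up] at h ⊢
    simp only [Raw.ren, ctxSubst_ren _ _ _ _ _ h, wkK_ren]; exact .betaMu _ _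
  | betaJmp l J => rw [instK_ren]; exact .betaJmp _ _
  | etaLam V h => simp only [Raw.ren, wk_ren]; exact .etaLam _ (by rwa [isValue_ren])
  | etaLet M => exact .etaLet _
  | etaMu M => simp only [Raw.ren, wkK_ren]; exact .etaMu _
  | exch J M => simp only [Raw.ren, wkK_ren]; exact .exch _ _
  | lam _ ih => exact .lam (ih _ _)
  | appL N _ ih => exact .appL _ (ih _ _)
  | appR M _ ih => exact .appR _ (ih _ _)
  | mu _ ih => exact .mu (ih _ _)
  | jmp k _ ih => exact .jmp _ (ih _ _)
  | letL N _ ih => exact .letL _ (ih _ _)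
  | letR M _ ih => exact .letR _ (ih _ _)

end Raw
end CCV

-- Weights of free variables

namespace CCV

/-- Extension of a weight on variables under a binder, whose variable gets weight `0`. -/
def upW (w : ℕ → ℕ) : ℕ → ℕ
  | 0 => 0
  | n + 1 => w n

theorem upW_comp_up (w ρ : ℕ → ℕ) : upW w ∘ up ρ = upW (w ∘ ρ) := by
  funext n; cases n <;> rfl

namespace Raw

/-- The total weight of the free occurrences of variables, where the ordinary variable `x` has
weight `v x` and the continuation variable `k` has weight `w k`. -/
def wt : {s : Cat} → (v w : ℕ → ℕ) → Raw s → ℕ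
  | _, v, _, var x => v x
  | _, v, w, lam M => wt (upW v) w M
  | _, v, w, app M N => wt v w M + wt v w N
  | _, v, w, mu J => wt v (upW w) J
  | _, v, w, jmp k M => w k + wt v w M
  | _, v, w, letE M N => wt (upW v) w M + wt v w N

theorem wt_ren {s : Cat} (M : Raw s) (v w ρ κ : ℕ → ℕ) :
    wt v w (M.ren ρ κ) = wt (v ∘ ρ) (w ∘ κ) M := by
  induction M generalizing v w ρ κ <;> simp_all [ren, wt, upW_comp_up]

theorem wt_wk {s : Cat} (M : Raw s) (v w : ℕ → ℕ) : wt (upW v) w M.wk = wt v w M :=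
  wt_ren _ _ _ _ _

theorem wt_wkK {s : Cat} (M : Raw s) (v w : ℕ → ℕ) : wt v (upW w) M.wkK = wt v w M :=
  wt_ren _ _ _ _ _

theorem wt_wkUnder {s : Cat} (M : Raw s) (v w : ℕ → ℕ) :
    wt (upW (upW v)) w M.wkUnder = wt (upW v) w M := by
  rw [wkUnder, wt_ren, upW_comp_up]; rfl

end Raw

/-- The total weight of the free occurrences of variables in a continuation. -/
def Ctx.wt (v w : ℕ → ℕ) : Ctx → ℕ
  | kvar k => w k
  | bind J => J.wt (upW v) w

theorem Ctx.wt_ren (C : Ctx) (v w ρ κ : ℕ → ℕ) :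
    (C.ren ρ κ).wt v w = C.wt (v ∘ ρ) (w ∘ κ) := by
  cases C <;> simp [Ctx.ren, Ctx.wt, Raw.wt_ren, upW_comp_up]

theorem Ctx.wt_plug (C : Ctx) (P : Raw .term) (v w : ℕ → ℕ) :
    (C.plug P).wt v w = C.wt v w + P.wt v w := by
  cases C <;> rfl

namespace Raw

theorem Eqv.wt {s : Cat} {M N : Raw s} (h : Eqv M N) (v w : ℕ → ℕ) : M.wt v w = N.wt v w := by
  induction h generalizing v w with
  | assoc L M N => simp only [Raw.wt, wt_wkUnder]; omega
  | jmpAssoc k L M => simp only [Raw.wt]; omega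
  | refl M => rfl
  | symm _ ih => exact (ih v w).symm
  | trans _ _ ih₁ ih₂ => exact (ih₁ v w).trans (ih₂ v w)
  | _ => simp only [Raw.wt, *]

theorem wt_liftV (σ : ℕ → Raw .term) (v w : ℕ → ℕ) :
    (fun n => (liftV σ n).wt (upW v) w) = upW fun n => (σ n).wt v w := by
  funext n
  cases n with
  | zero => rfl
  | succ n => exact wt_wk _ _ _

theorem wt_liftC (τ : ℕ → Ctx) (v w : ℕ → ℕ) :
    (fun n => (liftC τ n).wt v (upW w)) = upW fun n => (τ n).wt v w := by
  funext n
  cases n with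
  | zero => rfl
  | succ n => exact Ctx.wt_ren _ _ _ _ _

/-- Each occurrence of a variable contributes the weight of its image. Weights serve as freshness
tests (weight zero) and as occurrence counts, with no separate notion of free variable. -/
theorem wt_rsub {s : Cat} (M : Raw s) (σ : ℕ → Raw .term) (τ : ℕ → Ctx) (v w : ℕ → ℕ) :
    (M.rsub σ τ).wt v w = M.wt (fun n => (σ n).wt v w) (fun n => (τ n).wt v w) := by
  induction M generalizing σ τ v w with
  | var x => rfl
  | lam M ih => simp only [rsub, wt, ih, wt_liftV, Ctx.wt_ren]; rfl
  | app M N ihM ihN => simp only [rsub, wt, ihM, ihN]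
  | mu J ih => simp only [rsub, wt, ih, wt_liftC, wt_wkK]
  | jmp k M ih => simp only [rsub, wt, Ctx.wt_plug, ih]
  | letE M N ihM ihN => simp only [rsub, wt, ihM, ihN, wt_liftV, Ctx.wt_ren]; rfl

/-- A vanishing weight says that every variable that occurs has weight zero, so it depends only on
the zero sets of `v` and `w`. -/
theorem wt_mono_zero {s : Cat} (M : Raw s) {v w v' w' : ℕ → ℕ} (hv : ∀ n, v n = 0 → v' n = 0)
    (hw : ∀ n, w n = 0 → w' n = 0) (h : M.wt v w = 0) : M.wt v' w' = 0 := by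
  have hu : ∀ {u u' : ℕ → ℕ}, (∀ n, u n = 0 → u' n = 0) → ∀ n, upW u n = 0 → upW u' n = 0 :=
    fun hu n => by cases n; exacts [id, hu _]
  induction M generalizing v w v' w' with
  | var x => exact hv x h
  | lam M ih => exact ih (hu hv) hw h
  | app M N ihM ihN =>
    simp only [wt, Nat.add_eq_zero_iff] at h ⊢; exact ⟨ihM hv hw h.1, ihN hv hw h.2⟩
  | mu J ih => exact ih hv (hu hw) h
  | jmp k M ih =>
    simp only [wt, Nat.add_eq_zero_iff] at h ⊢; exact ⟨hw _ h.1, ih hv hw h.2⟩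
  | letE M N ihM ihN =>
    simp only [wt, Nat.add_eq_zero_iff] at h ⊢; exact ⟨ihM (hu hv) hw h.1, ihN hv hw h.2⟩

theorem ren_congr {s : Cat} (M : Raw s) {v w ρ κ ρ' κ' : ℕ → ℕ} (hv : ∀ n, v n = 0 → ρ n = ρ' n)
    (hw : ∀ n, w n = 0 → κ n = κ' n) (h : M.wt v w = 0) : M.ren ρ κ = M.ren ρ' κ' := by
  have hu : ∀ {u ρ ρ' : ℕ → ℕ}, (∀ n, u n = 0 → ρ n = ρ' n) →
      ∀ n, upW u n = 0 → up ρ n = up ρ' n :=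
    fun hu n h => by
      cases n with
      | zero => rfl
      | succ n => exact congrArg Nat.succ (hu _ h)
  induction M generalizing v w ρ κ ρ' κ' with
  | var x => exact congrArg var (hv x h)
  | lam M ih => exact congrArg lam (ih (hu hv) hw h)
  | app M N ihM ihN =>
    simp only [wt, Nat.add_eq_zero_iff] at h
    simp only [ren, ihM hv hw h.1, ihN hv hw h.2]
  | mu J ih => exact congrArg mu (ih hv (hu hw) h)
  | jmp k M ih =>
    simp only [wt, Nat.add_eq_zero_iff] at h
    simp only [ren, hw _ h.1, ih hv hw h.2]
  | letE M N ihM ihN =>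
    simp only [wt, Nat.add_eq_zero_iff] at h
    simp only [ren, ihM (hu hv) hw h.1, ihN hv hw h.2]

/-- The weight that counts the occurrences of the variable `n`. -/
def single (n : ℕ) : ℕ → ℕ := fun m => if m = n then 1 else 0

theorem upW_single (n : ℕ) : upW (single n) = single (n + 1) := by
  funext m; cases m <;> simp [upW, single]

theorem upW_zero : upW (fun _ => 0) = fun _ => 0 := by
  funext m; cases m <;> rfl

theorem wt_zero {s : Cat} (M : Raw s) : M.wt (fun _ => 0) (fun _ => 0) = 0 := by
  induction M <;> simp_all [wt, upW_zero]

theorem wt_wkK_single {s : Cat} (M : Raw s) : M.wkK.wt (fun _ => 0) (single 0) = 0 := by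
  rw [wkK, wt_ren]; exact wt_zero M

theorem wkK_pred {s : Cat} (M : Raw s) : M.wkK.ren id Nat.pred = M := by
  rw [wkK, ren_ren]; exact ren_id M

theorem ne_zero_of_single {n : ℕ} (h : single 0 n = 0) : n ≠ 0 := by
  rintro rfl; simp [single] at h

theorem pred_wk {s : Cat} (M : Raw s) (h : M.wt (single 0) (fun _ => 0) = 0) :
    (M.ren Nat.pred id).wk = M := by
  rw [wk, ren_ren]
  conv_rhs => rw [← ren_id M]
  exact ren_congr M (fun n hn => Nat.succ_pred (ne_zero_of_single hn)) (fun _ _ => rfl) h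

theorem pred_wkK {s : Cat} (M : Raw s) (h : M.wt (fun _ => 0) (single 0) = 0) :
    (M.ren id Nat.pred).wkK = M := by
  rw [wkK, ren_ren]
  conv_rhs => rw [← ren_id M]
  exact ren_congr M (fun _ _ => rfl) (fun n hn => Nat.succ_pred (ne_zero_of_single hn)) h

theorem wt_ctxSubst {s : Cat} (E : Raw s) (k : ℕ) (M : Raw .term) {v w : ℕ → ℕ}
    (hM : M.wt (upW v) w = 0) (hE : E.wt v w = 0) : (ctxSubst k M E).wt v w = 0 := by
  induction E generalizing k M v w with
  | var x => exact hE
  | lam P ih => exact ih _ _ (by rwa [wt_wkUnder]) hE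
  | app P Q ihP ihQ =>
    simp only [wt, ctxSubst, Nat.add_eq_zero_iff] at hE ⊢
    exact ⟨ihP _ _ hM hE.1, ihQ _ _ hM hE.2⟩
  | mu J ih => exact ih _ _ (by rwa [wt_wkK]) hE
  | jmp l P ih =>
    simp only [wt, ctxSubst, Nat.add_eq_zero_iff] at hE ⊢
    split <;> simp only [wt, Nat.add_eq_zero_iff]
    exacts [⟨hE.1, hM, ih _ _ hM hE.2⟩, ⟨hE.1, ih _ _ hM hE.2⟩]
  | letE P Q ihP ihQ =>
    simp only [wt, ctxSubst, Nat.add_eq_zero_iff] at hE ⊢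
    exact ⟨ihP _ _ (by rwa [wt_wkUnder]) hE.1, ihQ _ _ hM hE.2⟩

/-- Reduction does not create free variables. -/
theorem Step.wt_eq_zero {s : Cat} {M N : Raw s} (h : Step M N) {v w : ℕ → ℕ}
    (hM : M.wt v w = 0) : N.wt v w = 0 := by
  induction h generalizing v w with
  | ad₁ N M h => simp only [wt, wt_wk, upW, Nat.add_eq_zero_iff] at hM ⊢; simp [hM]
  | ad₂ V N h h' => simp only [wt, wt_wk, upW, Nat.add_eq_zero_iff] at hM ⊢; simp [hM]
  | betaLam M V h => exact hM
  | betaLet M V h =>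
    simp only [wt, Nat.add_eq_zero_iff] at hM
    rw [inst_eq_rsub, wt_rsub]
    exact wt_mono_zero M (fun n hn => by cases n; exacts [hM.2, hn]) (fun n hn => hn) hM.1
  | betaMu M J =>
    simp only [wt, Nat.add_eq_zero_iff] at hM
    exact wt_ctxSubst _ _ _ (by rw [wt_wkK]; exact hM.1) hM.2
  | betaJmp l J =>
    simp only [wt, Nat.add_eq_zero_iff] at hM
    rw [instK, wt_ren]
    exact wt_mono_zero J (fun n hn => hn) (fun n hn => by cases n; exacts [hM.1, hn]) hM.2
  | etaLam V h => simp only [wt, wt_wk, Nat.add_eq_zero_iff] at hM; exact hM.1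
  | etaLet M => simp only [wt, Nat.add_eq_zero_iff] at hM; exact hM.2
  | etaMu M => simp only [wt, wt_wkK, Nat.add_eq_zero_iff] at hM; exact hM.2
  | exch J M => simp only [wt, wt_wkK, Nat.add_eq_zero_iff] at hM ⊢; exact hM
  | lam _ ih => exact ih hM
  | mu _ ih => exact ih hM
  | appL N _ ih =>
    simp only [wt, Nat.add_eq_zero_iff] at hM ⊢; exact ⟨ih hM.1, hM.2⟩
  | appR N _ ih =>
    simp only [wt, Nat.add_eq_zero_iff] at hM ⊢; exact ⟨hM.1, ih hM.2⟩
  | jmp N _ ih =>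
    simp only [wt, Nat.add_eq_zero_iff] at hM ⊢; exact ⟨hM.1, ih hM.2⟩
  | letL N _ ih =>
    simp only [wt, Nat.add_eq_zero_iff] at hM ⊢; exact ⟨ih hM.1, hM.2⟩
  | letR N _ ih =>
    simp only [wt, Nat.add_eq_zero_iff] at hM ⊢; exact ⟨hM.1, ih hM.2⟩

-- Reduction modulo syntactic equality

/-- The class of a raw expression up to syntactic equality. -/
def cls {s : Cat} (M : Raw s) : Expr s := Quotient.mk _ M

/-- Reduction in any number of steps between the classes of raw expressions. -/
def Reds {s : Cat} (M N : Raw s) : Prop := Relation.ReflTransGen Expr.Red M.cls N.cls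

/-- Reduction in at least one step between the classes of raw expressions. -/
def Redp {s : Cat} (M N : Raw s) : Prop := Relation.TransGen Expr.Red M.cls N.cls

theorem Eqv.cls_eq {s : Cat} {M N : Raw s} (h : Eqv M N) : M.cls = N.cls := Quotient.sound h

theorem Eqv.reds {s : Cat} {M N : Raw s} (h : Eqv M N) : Reds M N := by
  rw [Reds, h.cls_eq]

theorem Step.redp {s : Cat} {M N : Raw s} (h : Step M N) : Redp M N :=
  .single ⟨M, N, rfl, rfl, h⟩

theorem Reds.trans {s : Cat} {L M N : Raw s} (h : Reds L M) (h' : Reds M N) : Reds L N :=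
  Relation.ReflTransGen.trans h h'

theorem Redp.reds {s : Cat} {M N : Raw s} (h : Redp M N) : Reds M N :=
  Relation.TransGen.to_reflTransGen h

theorem Redp.trans_reds {s : Cat} {L M N : Raw s} (h : Redp L M) (h' : Reds M N) : Redp L N :=
  Relation.TransGen.trans_left h h'

theorem Reds.trans_redp {s : Cat} {L M N : Raw s} (h : Reds L M) (h' : Redp M N) : Redp L N :=
  Relation.TransGen.trans_right h h'

/-- A map that preserves syntactic equality and reduction steps, on expressions. -/
theorem exists_lift {s t : Cat} (f : Raw s → Raw t) (hE : ∀ {M N}, Eqv M N → Eqv (f M) (f N))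
    (hS : ∀ {M N}, Step M N → Step (f M) (f N)) :
    ∃ F : Expr s → Expr t, (∀ M, F M.cls = (f M).cls) ∧
      ∀ a b, Expr.Red a b → Expr.Red (F a) (F b) := by
  refine ⟨Quotient.map f fun _ _ h => hE h, fun _ => rfl, ?_⟩
  rintro _ _ ⟨M, N, rfl, rfl, h⟩
  exact ⟨_, _, rfl, rfl, hS h⟩

theorem Reds.map {s t : Cat} (f : Raw s → Raw t) (hE : ∀ {M N}, Eqv M N → Eqv (f M) (f N))
    (hS : ∀ {M N}, Step M N → Step (f M) (f N)) {M N : Raw s} (h : Reds M N) :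
    Reds (f M) (f N) := by
  obtain ⟨F, hF, hR⟩ := exists_lift f hE hS
  rw [Reds, ← hF, ← hF]
  exact Relation.ReflTransGen.lift F hR _ _ h

theorem Redp.map {s t : Cat} (f : Raw s → Raw t) (hE : ∀ {M N}, Eqv M N → Eqv (f M) (f N))
    (hS : ∀ {M N}, Step M N → Step (f M) (f N)) {M N : Raw s} (h : Redp M N) :
    Redp (f M) (f N) := by
  obtain ⟨F, hF, hR⟩ := exists_lift f hE hS
  rw [Redp, ← hF, ← hF]
  exact Relation.TransGen.lift F hR _ _ h

theorem Reds.ren {s : Cat} {M N : Raw s} (h : Reds M N) (ρ κ : ℕ → ℕ) :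
    Reds (M.ren ρ κ) (N.ren ρ κ) :=
  h.map _ (fun h => h.ren ρ κ) fun h => h.ren ρ κ

theorem Redp.ren {s : Cat} {M N : Raw s} (h : Redp M N) (ρ κ : ℕ → ℕ) :
    Redp (M.ren ρ κ) (N.ren ρ κ) :=
  h.map _ (fun h => h.ren ρ κ) fun h => h.ren ρ κ

theorem Reds.lam {M N : Raw .term} (h : Reds M N) : Reds (lam M) (lam N) := h.map _ .lam .lam
theorem Reds.mu {M N : Raw .jump} (h : Reds M N) : Reds (mu M) (mu N) := h.map _ .mu .mu
theorem Reds.appL {M N : Raw .term} (h : Reds M N) (P : Raw .term) : Reds (app M P) (app N P) :=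
  h.map (app · P) (fun h => .app h (.refl P)) (.appL P)
theorem Reds.appR {M N : Raw .term} (h : Reds M N) (P : Raw .term) : Reds (app P M) (app P N) :=
  h.map _ (.app (.refl P)) (.appR P)
theorem Reds.jmp {M N : Raw .term} (h : Reds M N) (k : ℕ) : Reds (jmp k M) (jmp k N) :=
  h.map _ (.jmp k) (.jmp k)
theorem Reds.letL {s : Cat} {M N : Raw s} (h : Reds M N) (P : Raw .term) :
    Reds (letE M P) (letE N P) :=
  h.map (letE · P) (fun h => .letE h (.refl P)) (.letL P)
theorem Reds.letR {s : Cat} {M N : Raw .term} (h : Reds M N) (P : Raw s) :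
    Reds (letE P M) (letE P N) :=
  h.map _ (.letE (.refl P)) (.letR P)
theorem Redp.lam {M N : Raw .term} (h : Redp M N) : Redp (lam M) (lam N) := h.map _ .lam .lam
theorem Redp.mu {M N : Raw .jump} (h : Redp M N) : Redp (mu M) (mu N) := h.map _ .mu .mu
theorem Redp.appL {M N : Raw .term} (h : Redp M N) (P : Raw .term) : Redp (app M P) (app N P) :=
  h.map (app · P) (fun h => .app h (.refl P)) (.appL P)
theorem Redp.appR {M N : Raw .term} (h : Redp M N) (P : Raw .term) : Redp (app P M) (app P N) :=
  h.map _ (.app (.refl P)) (.appR P)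
theorem Redp.jmp {M N : Raw .term} (h : Redp M N) (k : ℕ) : Redp (jmp k M) (jmp k N) :=
  h.map _ (.jmp k) (.jmp k)
theorem Redp.letL {s : Cat} {M N : Raw s} (h : Redp M N) (P : Raw .term) :
    Redp (letE M P) (letE N P) :=
  h.map (letE · P) (fun h => .letE h (.refl P)) (.letL P)
theorem Redp.letR {s : Cat} {M N : Raw .term} (h : Redp M N) (P : Raw s) :
    Redp (letE P M) (letE P N) :=
  h.map _ (.letE (.refl P)) (.letR P)

theorem Reds.plug {M N : Raw .term} (h : Reds M N) (C : Ctx) : Reds (C.plug M) (C.plug N) := by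
  cases C with
  | kvar k => exact h.jmp k
  | bind J => exact h.letR J

/-- Reduction does not create free variables. -/
theorem Reds.wt_eq_zero {s : Cat} {M N : Raw s} (h : Reds M N) {v w : ℕ → ℕ}
    (hM : M.wt v w = 0) : N.wt v w = 0 := by
  have : ∀ b, Relation.ReflTransGen Expr.Red M.cls b → ∀ N : Raw s, N.cls = b → N.wt v w = 0 := by
    intro b hb
    induction hb with
    | refl => intro N hN; rw [← hM]; exact Eqv.wt (Quotient.exact hN) v w
    | tail _ h ih =>
      rintro N rfl
      obtain ⟨M', N', h₁, h₂, h⟩ := h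
      rw [← Eqv.wt (Quotient.exact h₂) v w]
      exact h.wt_eq_zero (ih _ h₁)
  exact this _ h N rfl

-- Reduction of jumps seen from their bodies

/-- A reduction step of a jump is a step of its body, or discards a `μ` in head position. -/
def JumpStep : (s : Cat) → Raw s → Raw s → Prop
  | .term, _, _ => True
  | .jump, J, J' => (∃ M, Redp J.body M ∧ Eqv J' (jmp J.head M)) ∨
      ∃ E, Reds J.body (mu E) ∧ Eqv J' (E.instK J.head)

theorem Step.jumpStep {s : Cat} {J J' : Raw s} (h : Step J J') : JumpStep s J J' := by
  induction h with
  | betaJmp l J => exact .inr ⟨J, (Eqv.refl _).reds, .refl _⟩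
  | jmp k h _ => exact .inl ⟨_, h.redp, .refl _⟩
  | @letL s J J' P h ih =>
    cases s
    · trivial
    · rcases ih with ⟨M, hM, hJ⟩ | ⟨E, hE, hJ⟩
      · exact .inl ⟨letE M P, hM.letL P, (Eqv.letE hJ (.refl P)).trans (.symm (.jmpAssoc _ _ _))⟩
      -- The let around the jump belongs to its body, where the exchange rule moves it under the
      -- exposed `μ`.
      · refine .inr ⟨letE E P.wkK, (hE.letL P).trans (Step.exch _ _).redp.reds, ?_⟩
        rw [letE_instK]
        exact .letE hJ (.refl P)
  | @letR s J P P' h ih =>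
    cases s
    · trivial
    · exact .inl ⟨letE J.body P', (h.redp).letR _,
        (Eqv.letE (eqv_jmp_head_body J) (.refl _)).trans (.symm (.jmpAssoc _ _ _))⟩
  | _ => trivial

/-- Reducts of `[k]M` with `k` not free in `M`. -/
theorem Reds.of_jmp_wkK {M : Raw .term} {J : Raw .jump} (h : Reds (Raw.jmp 0 M.wkK) J) :
    ∃ M', Reds M M' ∧ (Eqv J (.jmp 0 M'.wkK) ∨ M' = .mu J) := by
  have : ∀ b, Relation.ReflTransGen Expr.Red (Raw.jmp 0 M.wkK).cls b → ∀ J : Raw .jump,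
      J.cls = b → ∃ M', Reds M M' ∧ (Eqv J (.jmp 0 M'.wkK) ∨ Eqv M' (.mu J)) := by
    intro b hb
    induction hb with
    | refl => intro J hJ; exact ⟨M, (Eqv.refl _).reds, .inl (Quotient.exact hJ)⟩
    | tail _ h ih =>
      rintro J rfl
      obtain ⟨J₁, J₂, h₁, h₂, h⟩ := h
      have h₂ : Eqv J₂ J := Quotient.exact h₂
      obtain ⟨M', hM', hJ | hJ⟩ := ih J₁ h₁
      · obtain ⟨hh, hb⟩ := hJ.head_body
        rcases h.jumpStep with ⟨N, hN, hJN⟩ | ⟨E, hE, hJE⟩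
        · have hN' : Redp M'.wkK N := hb.symm.reds.trans_redp hN
          -- Reduction creates no free variables, so the new body is again a weakening and the step
          -- descends to `M'`.
          have hp := pred_wkK N (hN'.reds.wt_eq_zero (wt_wkK_single M'))
          have hr := hN'.ren id Nat.pred
          rw [wkK_pred] at hr
          rw [hh] at hJN
          exact ⟨_, hM'.trans hr.reds, .inl (by rw [hp]; exact h₂.symm.trans hJN)⟩
        · have hE' : Reds M'.wkK (Raw.mu E) := hb.symm.reds.trans hE
          have h0 := hE'.wt_eq_zero (wt_wkK_single M')
          have hr := hE'.ren id Nat.pred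
          rw [wkK_pred] at hr
          refine ⟨_, hM'.trans hr, .inr (.mu ?_)⟩
          -- Index `1`, the outer variable, does not occur in `E`. On all other indices, lowering
          -- under the `μ` and replacing its variable by the outer one agree.
          have e : E.ren id (up Nat.pred) = E.instK 0 := by
            rw [Raw.wt, upW_single] at h0
            refine ren_congr E (fun _ _ => rfl) (fun n hn => ?_) h0
            match n with
            | 0 => rfl
            | 1 => simp [single] at hn
            | n + 2 => rfl
          rw [e]
          rw [hh] at hJE
          exact hJE.symm.trans h₂
      -- Once a `μ` has surfaced, later steps of the jump are steps under it.
      · exact ⟨.mu J, hM'.trans (hJ.reds.trans (h.mu.redp.reds.trans h₂.mu.reds)),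
          .inr (.refl _)⟩
  obtain ⟨M', hM', hJ | hJ⟩ := this _ h J rfl
  · exact ⟨M', hM', .inl hJ⟩
  · exact ⟨_, hM'.trans hJ.reds, .inr rfl⟩

end Raw
end CCV

-- Weights and sizes in the target

namespace CCV
open Raw (liftV liftC upW_single pred_wk pred_wkK single cons)

namespace Tgt

/-- The total weight of the free occurrences of variables. -/
def wt : {s : Srt} → (v w : ℕ → ℕ) → Tgt s → ℕ
  | _, v, w, lamK Q => wt v (upW w) Q
  | _, v, w, appV W U => wt v w W + wt v w U
  | _, v, w, appK K W => wt v w K + wt v w W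
  | _, v, w, appT T K => wt v w T + wt v w K
  | _, v, _, var x => v x
  | _, v, w, lamT T => wt (upW v) w T
  | _, _, w, kvar k => w k
  | _, v, w, lamQ Q => wt (upW v) w Q

/-- The number of applications and abstractions. -/
def size : {s : Srt} → Tgt s → ℕ
  | _, lamK Q => size Q + 1
  | _, appV W U => size W + size U + 1
  | _, appK K W => size K + size W + 1
  | _, appT T K => size T + size K + 1
  | _, var _ => 0
  | _, lamT T => size T + 1
  | _, kvar _ => 0
  | _, lamQ Q => size Q + 1

theorem wt_ren {s : Srt} (P : Tgt s) (v w ρ κ : ℕ → ℕ) :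
    wt v w (P.ren ρ κ) = wt (v ∘ ρ) (w ∘ κ) P := by
  induction P generalizing v w ρ κ <;> simp_all [ren, wt, upW_comp_up]

theorem wt_zero {s : Srt} (P : Tgt s) : P.wt (fun _ => 0) (fun _ => 0) = 0 := by
  induction P <;> simp_all [wt, Raw.upW_zero]

theorem wt_wk_single {s : Srt} (P : Tgt s) : P.wk.wt (single 0) (fun _ => 0) = 0 := by
  rw [wk, wt_ren]; exact wt_zero P

theorem wt_wkK_single {s : Srt} (P : Tgt s) : P.wkK.wt (fun _ => 0) (single 0) = 0 := by
  rw [wkK, wt_ren]; exact wt_zero P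

theorem ren_id {s : Srt} (P : Tgt s) : P.ren id id = P := by
  induction P <;> simp_all [ren, up_id]

theorem wk_pred {s : Srt} (P : Tgt s) : P.wk.ren Nat.pred id = P := by
  rw [wk, ren_ren]; exact ren_id P

theorem wkK_pred {s : Srt} (P : Tgt s) : P.wkK.ren id Nat.pred = P := by
  rw [wkK, ren_ren]; exact ren_id P

theorem size_ren {s : Srt} (P : Tgt s) (ρ κ : ℕ → ℕ) : (P.ren ρ κ).size = P.size := by
  induction P generalizing ρ κ <;> simp_all [ren, size]

/-- Variables have size zero, so each substituted occurrence adds exactly the size of its image. -/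
theorem size_subst {s : Srt} (P : Tgt s) (σ : ℕ → Tgt .value) (τ : ℕ → Tgt .cont) :
    (P.subst σ τ).size = P.size + P.wt (fun n => (σ n).size) fun n => (τ n).size := by
  have hV : ∀ σ : ℕ → Tgt .value,
      (fun n => size (Nat.casesOn n (var 0) fun m => (σ m).wk : Tgt .value)) =
        upW fun n => (σ n).size := fun σ => by
    funext n
    cases n with
    | zero => rfl
    | succ n => exact size_ren _ _ _
  have hK : ∀ τ : ℕ → Tgt .cont,
      (fun n => size (Nat.casesOn n (kvar 0) fun m => (τ m).wkK : Tgt .cont)) =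
        upW fun n => (τ n).size := fun σ => by
    funext n
    cases n with
    | zero => rfl
    | succ n => exact size_ren _ _ _
  induction P generalizing σ τ with
  | lamK Q ih => simp only [subst, size, wt, ih, hK]; simp only [wkK, size_ren]; omega
  | lamT Q ih => simp only [subst, size, wt, ih, hV]; simp only [wk, size_ren]; omega
  | lamQ Q ih => simp only [subst, size, wt, ih, hV]; simp only [wk, size_ren]; omega
  | var x => simp only [subst, size, wt]; omega
  | kvar x => simp only [subst, size, wt]; omega
  | _ => simp only [subst, size, wt, *]; omega

theorem wt_mul {s : Srt} (P : Tgt s) (c : ℕ) (v w : ℕ → ℕ) :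
    P.wt (fun n => v n * c) (fun n => w n * c) = P.wt v w * c := by
  have hu : ∀ u : ℕ → ℕ, upW (fun n => u n * c) = fun n => upW u n * c := fun u => by
    funext n; cases n <;> simp [upW]
  induction P generalizing v w <;> simp_all [wt, add_mul]

theorem size_instK (Q : Tgt .jump) (K : Tgt .cont) :
    (Q.instK K).size = Q.size + Q.wt (fun _ => 0) (single 0) * K.size := by
  rw [instK, size_subst, ← wt_mul]
  congr 2
  · funext n; simp [size]
  · funext n; cases n <;> simp [size, single]

end Tgt

-- The inverse translation

/-- Source expressions that correspond to the sorts of the target. -/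
abbrev Obj : Srt → Type
  | .term => Raw .term
  | .jump => Raw .jump
  | .value => Raw .term
  | .cont => Ctx

namespace Obj

/-- Renaming of free variables. -/
def ren : {s : Srt} → (ρ κ : ℕ → ℕ) → Obj s → Obj s
  | .term, ρ, κ, M => Raw.ren ρ κ M
  | .jump, ρ, κ, M => Raw.ren ρ κ M
  | .value, ρ, κ, M => Raw.ren ρ κ M
  | .cont, ρ, κ, C => Ctx.ren ρ κ C

/-- Simultaneous substitution. -/
def rsub : {s : Srt} → (σ : ℕ → Raw .term) → (τ : ℕ → Ctx) → Obj s → Obj s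
  | .term, σ, τ, M => Raw.rsub σ τ M
  | .jump, σ, τ, M => Raw.rsub σ τ M
  | .value, σ, τ, M => Raw.rsub σ τ M
  | .cont, _, τ, .kvar k => τ k
  | .cont, σ, τ, .bind J => .bind (Raw.rsub (liftV σ) (fun n => (τ n).ren Nat.succ id) J)

theorem rsub_plug (C : Ctx) (P : Raw .term) (σ : ℕ → Raw .term) (τ : ℕ → Ctx) :
    Raw.rsub σ τ (C.plug P) = Ctx.plug (Obj.rsub (s := .cont) σ τ C) (Raw.rsub σ τ P) := by
  cases C <;> rfl

/-- The total weight of the free occurrences of variables. -/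
def wt : {s : Srt} → (v w : ℕ → ℕ) → Obj s → ℕ
  | .term, v, w, M => Raw.wt v w M
  | .jump, v, w, M => Raw.wt v w M
  | .value, v, w, M => Raw.wt v w M
  | .cont, v, w, C => Ctx.wt v w C

end Obj

/-- The inverse translation, as a relation: `λk.Q` corresponds to `μk.J`, and also to `M` if
`J` is `[k]M` with `k` not free in `M`. -/
def Rel : {s : Srt} → Tgt s → Obj s → Prop
  | _, .lamK Q, M => ∃ J, Rel Q J ∧ (M = Raw.mu J ∨ Raw.Eqv J (.jmp 0 (Raw.wkK M)))
  | _, .appV W U, M => ∃ V V', Rel W V ∧ Rel U V' ∧ M = Raw.app V V'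
  | _, .appK K W, J => ∃ C V, Rel K C ∧ Rel W V ∧ J = Ctx.plug C V
  | _, .appT T K, J => ∃ M C, Rel T M ∧ Rel K C ∧ J = Ctx.plug C M
  | _, .var x, V => V = Raw.var x
  | _, .lamT T, V => ∃ M, Rel T M ∧ V = Raw.lam M
  | _, .kvar k, C => C = .kvar k
  | _, .lamQ Q, C => ∃ J, Rel Q J ∧ C = .bind J

namespace Rel

theorem lamQ {Q : Tgt .jump} {J : Raw .jump} (h : Rel Q J) : Rel (.lamQ Q) (.bind J) :=
  ⟨J, h, rfl⟩

theorem app {W U : Tgt .value} {K : Tgt .cont} {V V' : Raw .term} {C : Ctx} (hW : Rel W V)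
    (hU : Rel U V') (hK : Rel K C) : Rel (.appT (.appV W U) K) (C.plug (.app V V')) :=
  ⟨_, _, ⟨_, _, hW, hU, rfl⟩, hK, rfl⟩

theorem isValue {W : Tgt .value} {V : Raw .term} (h : Rel W V) : V.isValue = true := by
  cases W with
  | var x => cases h; rfl
  | lamT T => obtain ⟨M, _, rfl⟩ := h; rfl

theorem ren {s : Srt} {P : Tgt s} {A : Obj s} (h : Rel P A) (ρ κ : ℕ → ℕ) :
    Rel (P.ren ρ κ) (A.ren ρ κ) := by
  induction P generalizing ρ κ with
  | lamK Q ih =>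
    obtain ⟨J, hJ, h⟩ := h
    refine ⟨_, ih hJ ρ (up κ), ?_⟩
    rcases h with rfl | h
    · exact .inl rfl
    · refine .inr ?_
      have := h.ren ρ (up κ)
      rwa [Raw.ren, Raw.wkK_ren] at this
  | appV W U ihW ihU =>
    obtain ⟨V, V', hW, hU, rfl⟩ := h
    exact ⟨_, _, ihW hW ρ κ, ihU hU ρ κ, rfl⟩
  | appK K W ihK ihW =>
    obtain ⟨C, V, hK, hW, rfl⟩ := h
    exact ⟨_, _, ihK hK ρ κ, ihW hW ρ κ, Ctx.plug_ren _ _ _ _⟩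
  | appT T K ihT ihK =>
    obtain ⟨M, C, hT, hK, rfl⟩ := h
    exact ⟨_, _, ihT hT ρ κ, ihK hK ρ κ, Ctx.plug_ren _ _ _ _⟩
  | var x => cases h; rfl
  | lamT T ih =>
    obtain ⟨M, hM, rfl⟩ := h
    exact ⟨_, ih hM (up ρ) κ, rfl⟩
  | kvar k => cases h; rfl
  | lamQ Q ih =>
    obtain ⟨J, hJ, rfl⟩ := h
    exact ⟨_, ih hJ (up ρ) κ, rfl⟩

/-- For a contracted `μ`, the extra occurrence of its variable has weight zero under `upW`. The
lemma transfers freshness, as needed for the η-rules, and occurrence counts, as needed for the size.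
-/
theorem wt {s : Srt} {P : Tgt s} {A : Obj s} (h : Rel P A) (v w : ℕ → ℕ) :
    P.wt v w = A.wt v w := by
  induction P generalizing v w with
  | lamK Q ih =>
    obtain ⟨J, hJ, h⟩ := h
    rw [Tgt.wt, ih hJ]
    rcases h with rfl | h
    · rfl
    · have := h.wt v (upW w)
      rw [Raw.wt, Raw.wt_wkK, upW, zero_add] at this
      exact this
  | appV W U ihW ihU =>
    obtain ⟨V, V', hW, hU, rfl⟩ := h
    rw [Tgt.wt, ihW hW, ihU hU]; rfl
  | appK K W ihK ihW =>
    obtain ⟨C, V, hK, hW, rfl⟩ := h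
    rw [Tgt.wt, ihK hK, ihW hW]; exact (Ctx.wt_plug _ _ _ _).symm
  | appT T K ihT ihK =>
    obtain ⟨M, C, hT, hK, rfl⟩ := h
    rw [Tgt.wt, ihT hT, ihK hK, add_comm]; exact (Ctx.wt_plug _ _ _ _).symm
  | var x => cases h; rfl
  | lamT T ih =>
    obtain ⟨M, hM, rfl⟩ := h
    rw [Tgt.wt, ih hM]; rfl
  | kvar k => cases h; rfl
  | lamQ Q ih =>
    obtain ⟨J, hJ, rfl⟩ := h
    rw [Tgt.wt, ih hJ]; rfl

/-- A contracted `μ` stays contracted because the lifted substitution fixes the bound variable `0`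
and maps weakenings to weakenings. -/
theorem subst {s : Srt} {P : Tgt s} {A : Obj s} (h : Rel P A) {σ : ℕ → Tgt .value}
    {τ : ℕ → Tgt .cont} {σ' : ℕ → Raw .term} {τ' : ℕ → Ctx} (hσ : ∀ n, Rel (σ n) (σ' n))
    (hτ : ∀ n, Rel (τ n) (τ' n)) : Rel (P.subst σ τ) (A.rsub σ' τ') := by
  induction P generalizing σ τ σ' τ' with
  | lamK Q ih =>
    obtain ⟨J, hJ, h⟩ := h
    have hσ' : ∀ n, Rel (σ n).wkK (σ' n).wkK := fun n => (hσ n).ren id Nat.succ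
    have hτ' : ∀ n, Rel (Nat.casesOn n (.kvar 0) fun m => (τ m).wkK : Tgt .cont) (liftC τ' n) :=
      fun n => by
        cases n with
        | zero => rfl
        | succ n => exact (hτ n).ren id Nat.succ
    refine ⟨_, ih hJ hσ' hτ', ?_⟩
    rcases h with rfl | h
    · exact .inl rfl
    · have := h.rsub (fun n => (σ' n).wkK) (liftC τ')
      refine .inr (this.trans ?_)
      rw [Raw.rsub, Raw.wkK, Raw.rsub_ren]
      show Raw.Eqv _ (Raw.jmp 0 (Raw.wkK (Raw.rsub σ' τ' A)))
      rw [Raw.wkK, Raw.ren_rsub]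
      exact .refl _
  | appV W U ihW ihU =>
    obtain ⟨V, V', hW, hU, rfl⟩ := h
    exact ⟨_, _, ihW hW hσ hτ, ihU hU hσ hτ, rfl⟩
  | appK K W ihK ihW =>
    obtain ⟨C, V, hK, hW, rfl⟩ := h
    exact ⟨_, _, ihK hK hσ hτ, ihW hW hσ hτ, Obj.rsub_plug _ _ _ _⟩
  | appT T K ihT ihK =>
    obtain ⟨M, C, hT, hK, rfl⟩ := h
    exact ⟨_, _, ihT hT hσ hτ, ihK hK hσ hτ, Obj.rsub_plug _ _ _ _⟩
  | var x => cases h; exact hσ x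
  | kvar k => cases h; exact hτ k
  | lamT T ih =>
    obtain ⟨M, hM, rfl⟩ := h
    refine ⟨_, ih (σ' := liftV σ') (τ' := fun n => (τ' n).ren Nat.succ id) hM
      (fun n => ?_) (fun n => (hτ n).ren Nat.succ id), rfl⟩
    cases n with
    | zero => rfl
    | succ n => exact (hσ n).ren Nat.succ id
  | lamQ Q ih =>
    obtain ⟨J, hJ, rfl⟩ := h
    refine ⟨_, ih (σ' := liftV σ') (τ' := fun n => (τ' n).ren Nat.succ id) hJ
      (fun n => ?_) (fun n => (hτ n).ren Nat.succ id), rfl⟩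
    cases n with
    | zero => rfl
    | succ n => exact (hσ n).ren Nat.succ id

theorem inst {s : Srt} {P : Tgt s} {A : Obj s} (h : Rel P A) {W : Tgt .value} {V : Raw .term}
    (hW : Rel W V) : Rel (P.inst W) (A.rsub (cons V Raw.var) .kvar) :=
  h.subst (fun n => by cases n; exacts [hW, rfl]) fun _ => rfl

theorem instK {s : Srt} {P : Tgt s} {A : Obj s} (h : Rel P A) {K : Tgt .cont} {C : Ctx}
    (hK : Rel K C) : Rel (P.instK K) (A.rsub Raw.var (cons C .kvar)) :=
  h.subst (fun _ => rfl) fun n => by cases n; exacts [hK, rfl]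

/-- Objects related to a weakening are weakenings. -/
theorem of_wk {P : Tgt .value} {A : Raw .term} (h : Rel P.wk A) :
    Rel P (A.ren Nat.pred id) ∧ (A.ren Nat.pred id).wk = A := by
  have := h.ren Nat.pred id
  rw [Tgt.wk_pred] at this
  exact ⟨this, pred_wk A ((h.wt _ _).symm.trans P.wt_wk_single)⟩

theorem of_wkK {P : Tgt .term} {A : Raw .term} (h : Rel P.wkK A) :
    Rel P (A.ren id Nat.pred) ∧ (A.ren id Nat.pred).wkK = A := by
  have := h.ren id Nat.pred
  rw [Tgt.wkK_pred] at this
  exact ⟨this, pred_wkK A ((h.wt _ _).symm.trans P.wt_wkK_single)⟩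

theorem of_wk_cont {K : Tgt .cont} {C : Ctx} (h : Rel K.wk C) :
    ∃ C', Rel K C' ∧ C = C'.ren Nat.succ id := by
  have hr := h.ren Nat.pred id
  rw [Tgt.wk_pred] at hr
  refine ⟨_, hr, ?_⟩
  have h0 : C.wt (single 0) (fun _ => 0) = 0 := (h.wt _ _).symm.trans K.wt_wk_single
  show C = (C.ren Nat.pred id).ren Nat.succ id
  rw [Ctx.ren_ren]
  cases C with
  | kvar k => rfl
  | bind J =>
    rw [Ctx.wt, upW_single] at h0
    refine congrArg Ctx.bind ?_
    conv_lhs => rw [← Raw.ren_id J]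
    refine Raw.ren_congr J (fun n hn => ?_) (fun _ _ => rfl) h0
    match n with
    | 0 => rfl
    | 1 => simp [single] at hn
    | n + 2 => rfl

end Rel

-- The CPS image is related to the term with named arguments

namespace Raw

/-- The normal form with respect to the two rules that name the non-values in applications. -/
def nameArgs : {s : Cat} → Raw s → Raw s
  | _, var x => var x
  | _, lam M => lam (nameArgs M)
  | _, app M N =>
    match M.isValue, N.isValue with
    | true, true => app (nameArgs M) (nameArgs N)
    | true, false => letE (app (nameArgs M).wk (var 0)) (nameArgs N)
    | false, true => letE (app (var 0) (nameArgs N).wk) (nameArgs M)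
    | false, false => letE (letE (app (var 1) (var 0)) (nameArgs N).wk) (nameArgs M)
  | _, mu J => mu (nameArgs J)
  | _, jmp k M => jmp k (nameArgs M)
  | _, letE M N => letE (nameArgs M) (nameArgs N)

theorem reds_nameArgs {s : Cat} (M : Raw s) : Reds M M.nameArgs := by
  induction M with
  | var x => exact (Eqv.refl _).reds
  | lam M ih => exact ih.lam
  | app M N ihM ihN =>
    have hN : Reds N.wk N.nameArgs.wk := ihN.ren _ _
    have hM : Reds M.wk M.nameArgs.wk := ihM.ren _ _
    cases h₁ : M.isValue <;> cases h₂ : N.isValue <;> simp only [nameArgs, h₁, h₂]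
    · refine (Step.ad₁ M N h₁).redp.reds.trans (.trans (.letL ?_ _) (ihM.letR _))
      exact (Step.ad₂ (var 0) N.wk rfl (by rwa [wk, isValue_ren])).redp.reds.trans (hN.letR _)
    · exact (Step.ad₁ M N h₁).redp.reds.trans (.trans (.letL (hN.appR _) _) (ihM.letR _))
    · exact (Step.ad₂ M N h₁ h₂).redp.reds.trans (.trans (.letL (hM.appL _) _) (ihN.letR _))
    · exact (ihM.appL _).trans (ihN.appR _)
  | mu J ih => exact ih.mu
  | jmp k M ih => exact ih.jmp k
  | letE M N ihM ihN => exact (ihM.letL _).trans (ihN.letR _)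

/-- The results of the colon translation are related to the named source expressions. -/
def RelOut (ρ κ : ℕ → ℕ) : (s : Cat) → Out s → Raw s → Prop
  | .term, F, M => ∀ K C, Rel K C → ∃ J : Raw .jump, Rel (F K) J ∧ Eqv J (C.plug (M.ren ρ κ))
  | .jump, Q, J => ∃ J' : Raw .jump, Rel Q J' ∧ Eqv J' (J.ren ρ κ)

theorem relOut_value {ρ κ : ℕ → ℕ} {W : Tgt .value} {V : Raw .term} (h : Rel W (V.ren ρ κ)) :
    RelOut ρ κ .term (fun K => .appK K W) V :=
  fun _ _ hK => ⟨_, ⟨_, _, hK, h, rfl⟩, .refl _⟩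

theorem rel_colon {s : Cat} (M : Raw s) (ρ κ : ℕ → ℕ) :
    RelOut ρ κ s (colon ρ κ M) M.nameArgs ∧
      match s, M with
      | .term, M => M.isValue = true → Rel (star ρ κ M) (M.nameArgs.ren ρ κ)
      | .jump, _ => True := by
  induction M generalizing ρ κ with
  | var x => exact ⟨relOut_value (V := .var x) rfl, fun _ => rfl⟩
  | lam M ih =>
    have h : Rel (star ρ κ (lam M)) ((lam M).nameArgs.ren ρ κ) := by
      obtain ⟨J, hJ, e⟩ := (ih (up ρ) (fun n => κ n + 1)).1 (.kvar 0) (.kvar 0) rfl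
      refine ⟨_, ⟨J, hJ, .inr ?_⟩, rfl⟩
      rw [wkK, ren_ren]
      exact e
    exact ⟨relOut_value h, fun _ => h⟩
  | app M N ihM ihN =>
    refine ⟨fun K C hK => ?_, fun h => by cases h⟩
    have hK₁ : Rel K.wk (C.ren Nat.succ id) := hK.ren _ _
    have hK₂ : Rel K.wk.wk ((C.ren Nat.succ id).ren Nat.succ id) := hK₁.ren _ _
    cases h₁ : M.isValue <;> cases h₂ : N.isValue <;> simp only [colon, nameArgs, h₁, h₂]
    · obtain ⟨J, hJ, e⟩ := (ihN (fun n => ρ n + 1) κ).1 _ _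
        (Rel.app (W := .var 1) (U := .var 0) (V := .var 1) (V' := .var 0) rfl rfl hK₂).lamQ
      obtain ⟨J', hJ', e'⟩ := (ihM ρ κ).1 _ _ hJ.lamQ
      refine ⟨J', hJ', e'.trans ((Eqv.letE e (.refl _)).trans (.trans ?_ (Eqv.plug_let _ _ _).symm))⟩
      refine .letE ?_ (.refl _)
      have e : N.nameArgs.wk.ren (up ρ) κ = N.nameArgs.ren (fun n => ρ n + 1) κ := by
        rw [wk, ren_ren]; rfl
      rw [ren, e]
      exact (Eqv.plug_let _ _ _).symm
    · have hN : Rel (star ρ κ N).wk (N.nameArgs.ren ρ κ).wk := ((ihN ρ κ).2 h₂).ren Nat.succ id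
      obtain ⟨J, hJ, e⟩ := (ihM ρ κ).1 _ _
        (Rel.app (W := .var 0) (V := .var 0) rfl hN hK₁).lamQ
      refine ⟨J, hJ, e.trans ?_⟩
      simp only [ren, wk_ren]
      exact (Eqv.plug_let _ _ _).symm
    · have hM : Rel (star ρ κ M).wk (M.nameArgs.ren ρ κ).wk := ((ihM ρ κ).2 h₁).ren Nat.succ id
      obtain ⟨J, hJ, e⟩ := (ihN ρ κ).1 _ _
        (Rel.app (U := .var 0) (V' := .var 0) hM rfl hK₁).lamQ
      refine ⟨J, hJ, e.trans ?_⟩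
      simp only [ren, wk_ren]
      exact (Eqv.plug_let _ _ _).symm
    · exact ⟨_, ⟨_, _, ⟨_, _, (ihM ρ κ).2 h₁, (ihN ρ κ).2 h₂, rfl⟩, hK, rfl⟩, .refl _⟩
  | mu J ih =>
    refine ⟨fun K C hK => ?_, fun h => by cases h⟩
    obtain ⟨J', hJ', e⟩ := (ih ρ (up κ)).1
    exact ⟨_, ⟨_, _, ⟨J', hJ', .inl rfl⟩, hK, rfl⟩, .plug _ (.mu e)⟩
  | jmp k M ih => exact ⟨(ih ρ κ).1 (.kvar (κ k)) (.kvar (κ k)) rfl, trivial⟩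
  | @letE s L M ihL ihM =>
    cases s
    · refine ⟨fun K C hK => ?_, fun h => by cases h⟩
      obtain ⟨J, hJ, e⟩ := (ihL (up ρ) κ).1 K.wk (C.ren Nat.succ id) (hK.ren _ _)
      obtain ⟨J', hJ', e'⟩ := (ihM ρ κ).1 _ _ hJ.lamQ
      exact ⟨J', hJ', e'.trans ((Eqv.letE e (.refl _)).trans (Eqv.plug_let _ _ _).symm)⟩
    · refine ⟨?_, trivial⟩
      obtain ⟨J, hJ, e⟩ := (ihL (up ρ) κ).1
      obtain ⟨J', hJ', e'⟩ := (ihM ρ κ).1 _ _ hJ.lamQ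
      exact ⟨J', hJ', e'.trans (Eqv.letE e (.refl _))⟩

theorem rel_cps (M : Raw .term) : Rel M.cps M.nameArgs := by
  obtain ⟨J, hJ, e⟩ := (rel_colon M id Nat.succ).1 (.kvar 0) (.kvar 0) rfl
  refine ⟨J, ?_, .inr e⟩
  rw [cln, wkK, (colon_ren M id id id Nat.succ).1]
  exact hJ

end Raw

end CCV

namespace CCV
open Raw (single cons)

/-- Simulation of a target step on jumps: the body is properly reduced, or, under the
condition `p`, there are any number of steps. -/
def JumpSim (p : Prop) (J J' : Raw .jump) : Prop :=
  (∃ l M M', Raw.Eqv J (.jmp l M) ∧ Raw.Redp M M' ∧ Raw.Reds (.jmp l M') J') ∨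
    p ∧ Raw.Reds J J'

/-- Simulation of a target step: there is at least one source step, unless the condition `p`
holds. -/
def Sim (p : Prop) : {s : Srt} → Obj s → Obj s → Prop
  | .term, M, N => Raw.Redp M N ∨ p ∧ Raw.Reds M N
  | .value, M, N => Raw.Redp M N ∨ p ∧ Raw.Reds M N
  | .jump, J, J' => JumpSim p J J'
  | .cont, C, C' => ∀ P, JumpSim p (C.plug P) (C'.plug P)

namespace JumpSim

open Raw

variable {p : Prop}

theorem mono {q : Prop} (hpq : p → q) {J J' : Raw .jump} (h : JumpSim p J J') :
    JumpSim q J J' := by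
  rcases h with h | ⟨hp, h⟩
  exacts [.inl h, .inr ⟨hpq hp, h⟩]

theorem letE {J J' : Raw .jump} (h : JumpSim p J J') (P : Raw .term) :
    JumpSim p (.letE J P) (.letE J' P) := by
  rcases h with ⟨l, M, M', h₁, h₂, h₃⟩ | ⟨hp, h⟩
  · refine .inl ⟨l, .letE M P, .letE M' P, ?_, h₂.letL P, ?_⟩
    · exact (Eqv.letE h₁ (.refl P)).trans (.symm (.jmpAssoc _ _ _))
    · exact (Eqv.jmpAssoc _ _ _).reds.trans (h₃.letL P)
  · exact .inr ⟨hp, h.letL P⟩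

theorem plug {M M' : Raw .term} (h : Redp M M' ∨ p ∧ Reds M M') (C : Ctx) :
    JumpSim p (C.plug M) (C.plug M') := by
  rcases h with h | ⟨hp, h⟩
  · cases C with
    | kvar l => exact .inl ⟨l, M, M', .refl _, h, (Eqv.refl _).reds⟩
    | bind J =>
      have e : ∀ P, Eqv (.letE J P) (.jmp J.head (.letE J.body P)) := fun P =>
        (Eqv.letE (eqv_jmp_head_body J) (.refl P)).trans (.symm (.jmpAssoc _ _ _))
      exact .inl ⟨_, _, _, e M, h.letR _, (e M').symm.reds⟩
  · exact .inr ⟨hp, h.plug C⟩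

theorem mu {J J' : Raw .jump} (h : JumpSim p J J') :
    Redp (.mu J) (.mu J') ∨ p ∧ Reds (.mu J) (.mu J') := by
  rcases h with ⟨l, M, M', h₁, h₂, h₃⟩ | ⟨hp, h⟩
  · exact .inl (h₁.reds.mu.trans_redp ((h₂.jmp l).mu.trans_reds h₃.mu))
  · exact .inr ⟨hp, h.mu⟩

/-- Simulation under a `μ` that has been contracted. -/
theorem of_wkK {M : Raw .term} {J J' : Raw .jump} (h : JumpSim p J J')
    (hJ : Eqv J (.jmp 0 M.wkK)) :
    ∃ M', (M' = .mu J' ∨ Eqv J' (.jmp 0 M'.wkK)) ∧ (Redp M M' ∨ p ∧ Reds M M') := by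
  rcases h with ⟨l, N, N', h₁, h₂, h₃⟩ | ⟨hp, h⟩
  · obtain ⟨rfl, e⟩ := (hJ.symm.trans h₁).jmp_inj
    have h₂ : Redp M.wkK N' := e.reds.trans_redp h₂
    have hw := pred_wkK N' (h₂.reds.wt_eq_zero (wt_wkK_single M))
    have hr := h₂.ren id Nat.pred
    rw [wkK_pred] at hr
    rw [← hw] at h₃
    obtain ⟨M', hM', h⟩ := h₃.of_jmp_wkK
    exact ⟨M', h.symm, .inl (hr.trans_reds hM')⟩
  · obtain ⟨M', hM', h⟩ := (hJ.symm.reds.trans h).of_jmp_wkK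
    exact ⟨M', h.symm, .inr ⟨hp, hM'⟩⟩

/-- A `μ` in a binding continuation. -/
theorem bind_mu (D J : Raw .jump) :
    JumpSim p (.letE D (.mu J)) (rsub var (cons (.bind D) .kvar) J) := by
  have hD := eqv_jmp_head_body D
  refine .inl ⟨D.head, .letE D.body (.mu J), _, ?_, (Step.betaMu _ _).redp,
    (Step.betaJmp _ _).redp.reds.trans (Eqv.reds ?_)⟩
  · exact (Eqv.letE hD (.refl _)).trans (.symm (.jmpAssoc _ _ _))
  · refine ctxSubst_ren_eqv J 0 _ _ _ D rfl ?_ fun j hj => ?_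
    · have e : D.body.wkK.ren id (fun n => Nat.casesOn n D.head fun m => m) = D.body := by
        rw [wkK, ren_ren]; exact ren_id _
      rw [e]
      exact hD
    · cases j; exacts [absurd rfl hj, rfl]

/-- A value in a binding continuation. -/
theorem bind_value (D : Raw .jump) {V : Raw .term} (hV : V.isValue = true) :
    JumpSim p (.letE D V) (D.rsub (cons V var) .kvar) := by
  have hD := eqv_jmp_head_body D
  refine .inl ⟨D.head, .letE D.body V, _, ?_, (Step.betaLet _ _ hV).redp, Eqv.reds ?_⟩
  · exact (Eqv.letE hD (.refl _)).trans (.symm (.jmpAssoc _ _ _))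
  · rw [inst_eq_rsub]
    exact (hD.rsub (cons V var) .kvar).symm

/-- The `η`-expansion of a continuation. -/
theorem eta (C : Ctx) (P : Raw .term) :
    JumpSim p (.letE ((C.ren Nat.succ id).plug (.var 0)) P) (C.plug P) := by
  cases C with
  | kvar k =>
    exact .inl ⟨k, .letE (.var 0) P, P, (Eqv.jmpAssoc _ _ _).symm, (Step.etaLet P).redp,
      (Eqv.refl _).reds⟩
  | bind D =>
    have h := bind_value (p := p) D.wkUnder (V := .var 0) rfl
    rw [← inst_eq_rsub, wkUnder_inst_var] at h
    exact h.letE P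

end JumpSim

/-- The inverse translation simulates reduction, up to steps that decrease the size. -/
theorem Rel.sim {s : Srt} {P P' : Tgt s} (h : Tgt.Step P P') {A : Obj s} (hA : Rel P A) :
    ∃ A', Rel P' A' ∧ Sim (P'.size < P.size) A A' := by
  induction h with
  | betaT T W =>
    obtain ⟨_, V, ⟨M, hT, rfl⟩, hW, rfl⟩ := hA
    refine ⟨_, hT.inst hW, .inl ?_⟩
    refine (Raw.Step.betaLam M V hW.isValue).redp.trans_reds ?_
    have h := (Raw.Step.betaLet M V hW.isValue).redp.reds
    rwa [Raw.inst_eq_rsub] at h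
  | betaQ Q W =>
    obtain ⟨_, V, ⟨J, hQ, rfl⟩, hW, rfl⟩ := hA
    exact ⟨_, hQ.inst hW, JumpSim.bind_value J hW.isValue⟩
  | betaK Q K =>
    obtain ⟨M, C, ⟨J, hQ, hM⟩, hK, rfl⟩ := hA
    refine ⟨_, hQ.instK hK, ?_⟩
    show JumpSim _ _ (Raw.rsub Raw.var (cons C .kvar) J)
    rcases hM with rfl | hM
    · cases C with
      | bind D => exact .bind_mu D J
      | kvar l =>
        refine .inr ⟨?_, ?_⟩
        · cases K with
          | kvar k => simp only [Tgt.size_instK, Tgt.size]; omega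
          | lamQ Q => obtain ⟨_, _, h⟩ := hK; cases h
        · rw [← Raw.instK_eq_rsub]
          exact (Raw.Step.betaJmp l J).redp.reds
    · refine .inr ⟨?_, Raw.Eqv.reds ?_⟩
      · have h : Q.wt (fun _ => 0) (single 0) = 1 := by
          rw [hQ.wt]
          refine (hM.wt _ _).trans ?_
          rw [Raw.wt, Raw.wt_wkK_single]
          rfl
        rw [Tgt.size_instK, h]
        simp only [Tgt.size]; omega
      · have h := hM.rsub Raw.var (cons C .kvar)
        rw [Raw.rsub, Raw.wkK_rsub_cons, Raw.rsub_id] at h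
        exact h.symm
  | etaT T =>
    obtain ⟨_, ⟨M, _, hT, rfl, rfl⟩, h⟩ := hA
    obtain ⟨hM, e⟩ := hT.of_wkK
    refine ⟨_, hM, ?_⟩
    rcases h with rfl | h
    · refine .inl ?_
      conv_lhs => rw [← e]
      exact (Raw.Step.etaMu _).redp
    · refine .inr ⟨?_, ?_⟩
      · simp only [Tgt.size, Tgt.wkK, Tgt.size_ren]; omega
      · have := h.jmp_inj.2.ren id Nat.pred
        rw [Raw.wkK_pred] at this
        exact this.symm.reds
  | etaW W =>
    obtain ⟨_, ⟨V, _, hW, rfl, rfl⟩, rfl⟩ := hA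
    obtain ⟨hV, e⟩ := hW.of_wk
    refine ⟨_, hV, .inl ?_⟩
    conv_lhs => rw [← e]
    exact (Raw.Step.etaLam _ hV.isValue).redp
  | etaK K =>
    obtain ⟨_, ⟨C, _, hK, rfl, rfl⟩, rfl⟩ := hA
    obtain ⟨C', hC', rfl⟩ := hK.of_wk_cont
    exact ⟨C', hC', JumpSim.eta C'⟩
  | lamK h ih =>
    obtain ⟨J, hQ, hM⟩ := hA
    obtain ⟨J', hJ', hs⟩ := ih hQ
    have hs := JumpSim.mono (Nat.add_lt_add_right · 1) hs
    rcases hM with rfl | hM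
    · exact ⟨_, ⟨J', hJ', .inl rfl⟩, hs.mu⟩
    · obtain ⟨M', h, h'⟩ := hs.of_wkK hM
      exact ⟨M', ⟨J', hJ', h⟩, h'⟩
  | appVL U h ih =>
    obtain ⟨V, V', hW, hU, rfl⟩ := hA
    obtain ⟨N, hN, hs⟩ := ih hW
    exact ⟨_, ⟨_, _, hN, hU, rfl⟩, Or.imp (Raw.Redp.appL · V')
      (And.imp (fun h => by simp only [Tgt.size]; omega) (Raw.Reds.appL · V')) hs⟩
  | appVR U h ih =>
    obtain ⟨V, V', hU, hW, rfl⟩ := hA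
    obtain ⟨N, hN, hs⟩ := ih hW
    exact ⟨_, ⟨_, _, hU, hN, rfl⟩, Or.imp (Raw.Redp.appR · V)
      (And.imp (fun h => by simp only [Tgt.size]; omega) (Raw.Reds.appR · V)) hs⟩
  | appKL W h ih =>
    obtain ⟨C, V, hK, hW, rfl⟩ := hA
    obtain ⟨C', hC', hs⟩ := ih hK
    exact ⟨_, ⟨_, _, hC', hW, rfl⟩, (hs V).mono fun h => by simp only [Tgt.size]; omega⟩
  | appKR K h ih =>
    obtain ⟨C, V, hK, hW, rfl⟩ := hA
    obtain ⟨V', hV', hs⟩ := ih hW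
    exact ⟨_, ⟨_, _, hK, hV', rfl⟩, (JumpSim.plug hs C).mono fun h => by
      simp only [Tgt.size]; omega⟩
  | appTL K h ih =>
    obtain ⟨M, C, hT, hK, rfl⟩ := hA
    obtain ⟨M', hM', hs⟩ := ih hT
    exact ⟨_, ⟨_, _, hM', hK, rfl⟩, (JumpSim.plug hs C).mono fun h => by
      simp only [Tgt.size]; omega⟩
  | appTR T h ih =>
    obtain ⟨M, C, hT, hK, rfl⟩ := hA
    obtain ⟨C', hC', hs⟩ := ih hK
    exact ⟨_, ⟨_, _, hT, hC', rfl⟩, (hs M).mono fun h => by simp only [Tgt.size]; omega⟩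
  | lamT h ih =>
    obtain ⟨M, hT, rfl⟩ := hA
    obtain ⟨M', hM', hs⟩ := ih hT
    exact ⟨_, ⟨_, hM', rfl⟩, Or.imp Raw.Redp.lam
      (And.imp (Nat.add_lt_add_right · 1) Raw.Reds.lam) hs⟩
  | lamQ h ih =>
    obtain ⟨J, hQ, rfl⟩ := hA
    obtain ⟨J', hJ', hs⟩ := ih hQ
    exact ⟨_, ⟨_, hJ', rfl⟩, fun P =>
      (JumpSim.letE hs P).mono (Nat.add_lt_add_right · 1)⟩

theorem stronglyNormalizing_iff_acc {α : Type} {r : α → α → Prop} {a : α} :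
    StronglyNormalizing r a ↔ Acc (fun x y => r y x) a := by
  rw [acc_iff_isEmpty_descending_chain, StronglyNormalizing, ← not_nonempty_iff, nonempty_subtype]

/-- A target term is strongly normalizing if it is related to a strongly normalizing term. -/
theorem Rel.acc {a : Expr .term} (ha : Acc (fun x y => Relation.TransGen Expr.Red y x) a)
    (n : ℕ) (T : Tgt .term) (hn : T.size = n) (M : Raw .term) (hM : M.cls = a) (h : Rel T M) :
    Acc (fun x y => Tgt.Step y x) T := by
  induction ha generalizing n T M with
  | intro a _ iha =>
    induction n using Nat.strong_induction_on generalizing T M with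
    | _ n ihn =>
      subst hn
      refine .intro _ fun T' hT' => ?_
      obtain ⟨M', hM', hs⟩ := h.sim hT'
      have key : Raw.Redp M M' → Acc (fun x y => Tgt.Step y x) T' := fun hs =>
        iha _ (hM ▸ hs) _ T' rfl M' rfl hM'
      rcases hs with hs | ⟨hlt, hs⟩
      · exact key hs
      · rcases Relation.reflTransGen_iff_eq_or_transGen.1 hs with e | hs
        · exact ihn _ hlt T' rfl M' (e.trans hM) hM'
        · exact key hs

end CCV

theorem mainTheorem4 (M : CCV.Term) (hM : StronglyNormalizing CCV.Expr.Red M) :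
    StronglyNormalizing CCV.Tgt.Step (CCV.Term.cps M) := by
  rw [CCV.stronglyNormalizing_iff_acc] at hM ⊢
  induction M using Quotient.inductionOn with
  | h M =>
    have hM : Acc (fun x y => Relation.TransGen CCV.Expr.Red y x) M.cls := by
      have := hM.transGen
      refine Subrelation.accessible (fun {x y} h => ?_) this
      exact Relation.transGen_swap.1 h
    have hN : Acc (fun x y => Relation.TransGen CCV.Expr.Red y x) M.nameArgs.cls := by
      rcases Relation.reflTransGen_iff_eq_or_transGen.1 M.reds_nameArgs with e | h
      · rwa [e]
      · exact hM.inv h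
    exact CCV.Rel.acc hN _ _ rfl _ rfl M.rel_cps
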